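/- \textbf{Theorem (Restarting for APPROX).} \label{th:restart_approx} \emph{Setting.} Let $f:\mathbb{R}^n\to\mathbb{R}$ be convex and differentiable, let $\psi(x)=\sum_{i=1}^n\psi^i(x^i)$ with $\psi^i:\mathbb{R}\to\mathbb{R}\cup\{+\infty\}$ be closed (lower semicontinuous) and convex, and let $F=f+\psi$ have a minimizer $x_*$. For a positive vector $v\in\mathbb{R}^n$ write $\|x\|_v^2=\sum_i v_i(x^i)^2$, and let $\mu_F(v)>0$ satisfy $$F(x)\ge F(x_*)+\tfrac{\mu_F(v)}{2}\|x-x_*\|_v^2\qquad\text{for all }x\in\mathbb{R}^n .$$ Let $\hat S$ be a random subset of $\{1,\dots,n\}$ such that $\mathbf{P}(i\in\hat S)$ is the same for all $i$, and such that $\tau:=\mathbf{E}|\hat S|>0$. For a set $S$ of coordinates let $h_{[S]}=\sum_{i\in S}h^ie_i$, and assume the expected separable overapproximation (ESO) $$\mathbf{E}\big[f(x+h_{[\hat S]})\big]\le f(x)+\tfrac{\tau}{n}\Big(\langle\nabla f(x),h\rangle+\tfrac12\|h\|_v^2\Big)\qquad\text{for all }x,h\in\mathbb{R}^n .$$ \emph{Algorithm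 (APPROX).} Let $x_0\in\operatorname{dom}\psi$, $z_0=x_0$, $\theta_0=\tau/n$, and let $S_0,S_1,\dots$ be independent copies of $\hat S$. For $k\ge0$ set $y_k=(1-\theta_k)x_k+\theta_kz_k$; $$z_{k+1}^i=\arg\min_{t\in\mathbb{R}}\Big\{\nabla_if(y_k)(t-y_k^i)+\tfrac{\theta_k n v_i}{2\tau}(t-z_k^i)^2+\psi^i(t)\Big\}\ \text{ for } i\in S_k,\qquad z_{k+1}^i=z_k^i\ \text{ for } i\notin S_k;$$ $$x_{k+1}=y_k+\tfrac n\tau\theta_k(z_{k+1}-z_k);\qquad \theta_{k+1}=\tfrac12\Big(\sqrt{\theta_k^4+4\theta_k^2}-\theta_k^2\Big).$$ \emph{Restart point.} Let $\gamma_0^0=1$, $\gamma_1^0=0$, $\gamma_1^1=1$ and, for $k\ge1$, $\gamma_{k+1}^i=(1-\theta_k)\gamma_k^i$ for $0\le i\le k-1$, $\gamma_{k+1}^k=\theta_k(1-\frac n\tau\theta_{k-1})+\frac n\tau(\theta_{k-1}-\theta_k)$ and $\gamma_{k+1}^{k+1}=\frac n\tau\theta_k$. With the convention $\frac1{\theta_{-1}^2}:=\frac{1-\theta_0}{\theta_0^2}$,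 put for $k\ge1$ $$\rho_k=\frac1{\theta_0\theta_{k-1}}-\frac{1-\theta_0}{\theta_0^2},\qquad W_k=\sum_{i=0}^{k-1}\frac{\gamma_k^i}{\theta_{i-1}^2}+\rho_k,\qquad \mathring x_k=\frac1{W_k}\Big(\sum_{i=0}^{k-1}\frac{\gamma_k^i}{\theta_{i-1}^2}x_i+\rho_kx_k\Big).$$ For $\sigma\in[0,1]$ let $\bar x_k=\sigma x_k+(1-\sigma)\mathring x_k$. Let $$\Delta(x)=\frac{1-\theta_0}{\theta_0^2}\big(F(x)-F(x_*)\big)+\frac1{2\theta_0^2}\|x-x_*\|_v^2,\qquad m_k(\mu)=\frac{\mu\theta_0^2}{1+\mu(1-\theta_0)}\,W_k .$$ \emph{Conclusion.} For every $k\ge1$ and every $\sigma\in[0,1]$: the weights $\gamma_k^i/\theta_{i-1}^2$ ($0\le i<k$) and $\rho_k$ are nonnegative and $W_k>0$, so that $\mathring x_k$ is a convex combination of $x_0,\dots,x_k$; $F(\bar x_k)$ is finite and $\Delta(\bar x_k)$ is integrable; and $$\mathbf{E}[\Delta(\bar x_k)]\le\max\big(\sigma,\,1-\sigma\,m_k(\mu_F(v))\big)\,\Delta(x_0).$$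 -/

import Mathlib

open MeasureTheory ProbabilityTheory Finset

namespace Approx

noncomputable section

/-- Closed convex extended-real function: convex epigraph and lower semicontinuity. -/
def IsClosedConvex {E : Type*} [AddCommGroup E] [Module ℝ E] [TopologicalSpace E]
    (g : E → EReal) : Prop :=
  Convex ℝ {p : E × ℝ | g p.1 ≤ (p.2 : EReal)} ∧ LowerSemicontinuous g

/-- The separable function `x ↦ ∑ i, ψ i (x i)`. -/
def separable {n : ℕ} (ψ : Fin n → ℝ → EReal) (x : EuclideanSpace ℝ (Fin n)) : EReal :=
  ∑ i, ψ i (x i)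

/-- The composite objective `F = f + ψ`. -/
def objective {n : ℕ} (f : EuclideanSpace ℝ (Fin n) → ℝ) (ψ : Fin n → ℝ → EReal)
    (x : EuclideanSpace ℝ (Fin n)) : EReal :=
  (f x : EReal) + separable ψ x

/-- The squared weighted Euclidean norm `‖x‖_v ^ 2 = ∑ i, v i * (x i) ^ 2`. -/
def wnormSq {n : ℕ} (v : Fin n → ℝ) (x : EuclideanSpace ℝ (Fin n)) : ℝ :=
  ∑ i, v i * (x i) ^ 2

/-- The vector that agrees with `h` on the coordinates in `A` and vanishes elsewhere. -/
def restrictTo {n : ℕ} (h : EuclideanSpace ℝ (Fin n)) (A : Finset (Fin n)) :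
    EuclideanSpace ℝ (Fin n) :=
  WithLp.toLp 2 fun i => if i ∈ A then h i else 0

/-- The expectation of `g` under the law `p` of a random subset of coordinates. -/
def sampleMean {n : ℕ} (p : PMF (Finset (Fin n))) (g : Finset (Fin n) → ℝ) : ℝ :=
  ∑ A, (p A).toReal * g A

/-- The probability that the random subset with law `p` contains `i`. -/
def inclusionProb {n : ℕ} (p : PMF (Finset (Fin n))) (i : Fin n) : ℝ :=
  sampleMean p fun A => if i ∈ A then 1 else 0

/-- `τ`: the expected cardinality of the random subset with law `p`. -/
def meanSize {n : ℕ} (p : PMF (Finset (Fin n))) : ℝ :=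
  sampleMean p fun A => (A.card : ℝ)

/-- Expected separable overapproximation, `(f, p) ∼ ESO(v)`. -/
def ESO {n : ℕ} (f : EuclideanSpace ℝ (Fin n) → ℝ) (p : PMF (Finset (Fin n)))
    (v : Fin n → ℝ) : Prop :=
  ∀ x h : EuclideanSpace ℝ (Fin n),
    sampleMean p (fun A => f (x + restrictTo h A)) ≤
      f x + meanSize p / n * (inner ℝ (gradient f x) h + 1 / 2 * wnormSq v h)

/-- The sequence `θ`, started at `θ₀`. -/
def theta (θ₀ : ℝ) : ℕ → ℝ
  | 0 => θ₀
  | k + 1 => (√(theta θ₀ k ^ 4 + 4 * theta θ₀ k ^ 2) - theta θ₀ k ^ 2) / 2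

/-- `argmin φ`: a global minimizer of `φ` (chosen arbitrarily if there are several or none). -/
def argmin (φ : ℝ → EReal) : ℝ :=
  Classical.epsilon fun t => ∀ s, φ t ≤ φ s

/-- The point `y` of one iteration. -/
def yPoint {n : ℕ} (θ : ℝ) (x z : EuclideanSpace ℝ (Fin n)) : EuclideanSpace ℝ (Fin n) :=
  (1 - θ) • x + θ • z

/-- The proximal coordinate update of `z`, on the coordinates in `A`. -/
def zUpdate {n : ℕ} (f : EuclideanSpace ℝ (Fin n) → ℝ) (ψ : Fin n → ℝ → EReal)
    (v : Fin n → ℝ) (τ θ : ℝ) (A : Finset (Fin n)) (x z : EuclideanSpace ℝ (Fin n)) :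
    EuclideanSpace ℝ (Fin n) :=
  WithLp.toLp 2 fun i =>
    if i ∈ A then
      argmin fun t =>
        ((gradient f (yPoint θ x z) i * (t - yPoint θ x z i)
          + θ * n * v i / (2 * τ) * (t - z i) ^ 2 : ℝ) : EReal) + ψ i t
    else z i

/-- The pair `(x_k, z_k)` of APPROX along the sequence `A` of sampled subsets,
with `θ₀ = τ / n`. -/
def iterate {n : ℕ} (f : EuclideanSpace ℝ (Fin n) → ℝ) (ψ : Fin n → ℝ → EReal)
    (v : Fin n → ℝ) (τ : ℝ) (x₀ : EuclideanSpace ℝ (Fin n)) (A : ℕ → Finset (Fin n)) :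
    ℕ → EuclideanSpace ℝ (Fin n) × EuclideanSpace ℝ (Fin n)
  | 0 => (x₀, x₀)
  | k + 1 =>
    let x := (iterate f ψ v τ x₀ A k).1
    let z := (iterate f ψ v τ x₀ A k).2
    let θ := theta (τ / n) k
    let z' := zUpdate f ψ v τ θ (A k) x z
    (yPoint θ x z + (n / τ * θ) • (z' - z), z')

/-- The coefficients `γ_k^i` (`gamma r θ₀ k i`), with `r = n / τ`. -/
def gamma (r θ₀ : ℝ) : ℕ → ℕ → ℝ
  | 0, i => if i = 0 then 1 else 0
  | 1, i => if i = 1 then 1 else 0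
  | k + 2, i =>
    if i ≤ k then (1 - theta θ₀ (k + 1)) * gamma r θ₀ (k + 1) i
    else if i = k + 1 then
      theta θ₀ (k + 1) * (1 - r * theta θ₀ k) + r * (theta θ₀ k - theta θ₀ (k + 1))
    else if i = k + 2 then r * theta θ₀ (k + 1)
    else 0

/-- `1 / θ_{i-1}^2`, with the convention `1 / θ_{-1}^2 = (1 - θ₀) / θ₀^2`. -/
def invSqPrev (θ₀ : ℝ) : ℕ → ℝ
  | 0 => (1 - θ₀) / θ₀ ^ 2
  | i + 1 => 1 / theta θ₀ i ^ 2

/-- The unnormalized weight `γ_k^i / θ_{i-1}^2` of `x_i` for `i < k`. -/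
def headWeight (r θ₀ : ℝ) (k i : ℕ) : ℝ :=
  gamma r θ₀ k i * invSqPrev θ₀ i

/-- The unnormalized weight of `x_k`, for `k ≥ 1`. -/
def lastWeight (θ₀ : ℝ) (k : ℕ) : ℝ :=
  1 / (θ₀ * theta θ₀ (k - 1)) - (1 - θ₀) / θ₀ ^ 2

/-- The sum of all the unnormalized weights, for `k ≥ 1`. -/
def totalWeight (r θ₀ : ℝ) (k : ℕ) : ℝ :=
  ∑ i ∈ range k, headWeight r θ₀ k i + lastWeight θ₀ k

/-- The averaged point `x̊_k` of a sequence `x`, for `k ≥ 1`. -/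
def ringPoint {n : ℕ} (r θ₀ : ℝ) (x : ℕ → EuclideanSpace ℝ (Fin n)) (k : ℕ) :
    EuclideanSpace ℝ (Fin n) :=
  (1 / totalWeight r θ₀ k) •
    (∑ i ∈ range k, headWeight r θ₀ k i • x i + lastWeight θ₀ k • x k)

/-- The restart point `x̄_k = σ x_k + (1 - σ) x̊_k`, for `k ≥ 1`. -/
def barPoint {n : ℕ} (r θ₀ σ : ℝ) (x : ℕ → EuclideanSpace ℝ (Fin n)) (k : ℕ) :
    EuclideanSpace ℝ (Fin n) :=
  σ • x k + (1 - σ) • ringPoint r θ₀ x k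

/-- `m_k(μ)`, for `k ≥ 1`. -/
def mCoeff (r θ₀ : ℝ) (k : ℕ) (μ : ℝ) : ℝ :=
  μ * θ₀ ^ 2 / (1 + μ * (1 - θ₀)) * totalWeight r θ₀ k

/-- The Lyapunov function `Δ`, at points where `F` is finite. -/
def lyapunov {n : ℕ} (F : EuclideanSpace ℝ (Fin n) → EReal) (v : Fin n → ℝ) (θ₀ : ℝ)
    (xs x : EuclideanSpace ℝ (Fin n)) : ℝ :=
  (1 - θ₀) / θ₀ ^ 2 * ((F x).toReal - (F xs).toReal) + 1 / (2 * θ₀ ^ 2) * wnormSq v (x - xs)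

end

end Approx

namespace Approx

/-! The iterate is a fixed convex combination `x_k = ∑ γ_k^i z_i` of the proximal points. Replace
`ψ(x_k)` by the larger quantity `∑ γ_k^i ψ(z_i)`, whose conditional expectation is computable
because each `z_i` changes coordinatewise. With this surrogate, the quantity `energy`, namely
`(f(x_k) + ∑ γ_k^i ψ(z_i) - F(x_*)) / θ_{k-1}^2 + ‖z_k - x_*‖_v^2 / (2 θ₀^2)`, is a supermartingale
started at `Δ(x₀)`. One step (`sampleMean_step_le`) combines the ESO, the proximal inequality of the
full update and convexity of `f`.

The restart bound comes from averaging the energies of all times `i ≤ k` with the weights `γ_k^i`,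
which sum to one. Jensen turns the distance terms into `‖x_k - x_*‖_v^2`, and the gap terms carry
the weights `γ_k^i / θ_{i-1}^2`. The weight of the last gap splits as `ρ_k + (1 - θ₀) / θ₀^2`: the
second part completes `Δ(x_k)`, and `ρ_k` joins the other weights to give `W_k (F(x̊_k) - F(x_*))`,
again by Jensen (`totalWeight_mul_gap_add_lyapunov_le`). Quadratic growth bounds this gap below by
`m_k Δ(x̊_k)`, whence `m_k E[Δ(x̊_k)] + E[Δ(x_k)] ≤ Δ(x₀)`.

Write `R = E[Δ(x̊_k)]`. Convexity of `Δ` gives `E[Δ(x̄_k)] ≤ σ Δ(x₀) + (1 - σ - σ m_k) R`. This is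
affine in `R ∈ [0, Δ(x₀)]`, and its two endpoint values are the two terms of the maximum. -/

/-- First-order characterization of convexity. -/
theorem add_inner_gradient_le {E : Type*} [NormedAddCommGroup E] [InnerProductSpace ℝ E]
    [CompleteSpace E] {f : E → ℝ} (hf : Differentiable ℝ f) (hc : ConvexOn ℝ Set.univ f)
    (x y : E) : f y + inner ℝ (gradient f y) (x - y) ≤ f x := by
  have h1 : ConvexOn ℝ Set.univ (f ∘ AffineMap.lineMap (k := ℝ) y x) := by
    simpa using hc.comp_affineMap (AffineMap.lineMap (k := ℝ) y x)
  have h2 : HasDerivAt (f ∘ AffineMap.lineMap (k := ℝ) y x) (fderiv ℝ f y (x - y)) 0 := by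
    have h3 : HasFDerivAt f (fderiv ℝ f y) (AffineMap.lineMap (k := ℝ) y x 0) := by
      simpa using (hf y).hasFDerivAt
    exact h3.comp_hasDerivAt (0 : ℝ) AffineMap.hasDerivAt_lineMap
  have h4 := h1.le_slope_of_hasDerivAt (Set.mem_univ 0) (Set.mem_univ 1) zero_lt_one h2
  rw [slope_def_field] at h4
  simp only [Function.comp, AffineMap.lineMap_apply_one, AffineMap.lineMap_apply_zero,
    sub_zero, div_one] at h4
  rw [inner_gradient_left]
  linarith

/-! ### Existence and strong optimality for one-dimensional proximal problems. -/

section OneDim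

variable {g : ℝ → EReal}

/-- A proper closed convex function on the line is bounded below by a function of linear growth. -/
theorem exists_linear_growth_lower_bound (hlsc : LowerSemicontinuous g) (hbot : ∀ t, g t ≠ ⊥)
    (hconv : ConvexOn ℝ {t | g t ≠ ⊤} fun t => (g t).toReal) {t₀ : ℝ} (ht₀ : g t₀ ≠ ⊤) :
    ∃ C : ℝ, 0 ≤ C ∧ ∀ t, (((g t₀).toReal - 1 - C * |t - t₀| : ℝ) : EReal) ≤ g t := by
  have hG : ∀ t, g t ≠ ⊤ → (((g t).toReal : ℝ) : EReal) = g t := fun t ht =>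
    EReal.coe_toReal ht (hbot t)
  have hlt : (((g t₀).toReal - 1 : ℝ) : EReal) < g t₀ := by
    rw [← hG t₀ ht₀, EReal.coe_lt_coe_iff, EReal.toReal_coe]; linarith
  obtain ⟨ε, hε, hball⟩ := Metric.eventually_nhds_iff.1 (hlsc t₀ _ hlt)
  refine ⟨2 / ε, by positivity, fun t => ?_⟩
  by_cases ht : g t = ⊤
  · rw [ht]; exact le_top
  rw [← hG t ht, EReal.coe_le_coe_iff]
  rcases lt_or_ge |t - t₀| ε with hlt' | hge
  · have h1 : (((g t₀).toReal - 1 : ℝ) : EReal) < g t := hball (y := t) (by rwa [Real.dist_eq])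
    rw [← hG t ht, EReal.coe_lt_coe_iff] at h1
    have : 0 ≤ 2 / ε * |t - t₀| := by positivity
    linarith
  · have hpos : 0 < |t - t₀| := hε.trans_le hge
    -- This `l` puts the point `(1 - l) t₀ + l t` at distance `ε / 2` from `t₀`, where
    -- semicontinuity gives a bound; convexity then carries the bound out to `t`, whence the slope
    -- `2 / ε`.
    set l : ℝ := ε / 2 / |t - t₀| with hl
    have hl0 : 0 < l := by positivity
    have hl1 : l ≤ 1 := by rw [hl, div_le_one hpos]; linarith
    have hcv := hconv.2 (x := t₀) (y := t) ht₀ ht (sub_nonneg.2 hl1) hl0.le (by ring)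
    have hdom := hconv.1 (x := t₀) (y := t) ht₀ ht (sub_nonneg.2 hl1) hl0.le (by ring)
    have h1 : (((g t₀).toReal - 1 : ℝ) : EReal) < g ((1 - l) • t₀ + l • t) := hball (by
      have : (1 - l) • t₀ + l • t - t₀ = l * (t - t₀) := by simp only [smul_eq_mul]; ring
      rw [Real.dist_eq, this, abs_mul, abs_of_pos hl0, hl, div_mul_cancel₀ _ hpos.ne']
      linarith)
    rw [← hG _ hdom, EReal.coe_lt_coe_iff] at h1
    simp only [smul_eq_mul] at hcv h1
    have h2 : -1 ≤ l * ((g t).toReal - (g t₀).toReal) := by linarith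
    have h3 : l * (2 / ε * |t - t₀|) = 1 := by rw [hl]; field_simp
    have h4 : 0 ≤ l * ((g t).toReal - (g t₀).toReal + 2 / ε * |t - t₀|) := by
      rw [mul_add, h3]; linarith
    have := nonneg_of_mul_nonneg_right h4 hl0
    linarith

/-- A proximal subproblem on the line has a solution. -/
theorem exists_prox (hlsc : LowerSemicontinuous g) (hbot : ∀ t, g t ≠ ⊥)
    (hconv : ConvexOn ℝ {t | g t ≠ ⊤} fun t => (g t).toReal) {t₀ : ℝ} (ht₀ : g t₀ ≠ ⊤)
    (a b z : ℝ) {c : ℝ} (hc : 0 < c) :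
    ∃ m, ∀ s, ((a * (m - b) + c * (m - z) ^ 2 : ℝ) : EReal) + g m ≤
      ((a * (s - b) + c * (s - z) ^ 2 : ℝ) : EReal) + g s := by
  obtain ⟨C, hC0, hC⟩ := exists_linear_growth_lower_bound hlsc hbot hconv ht₀
  set φ : ℝ → EReal := fun t => ((a * (t - b) + c * (t - z) ^ 2 : ℝ) : EReal) + g t with hφ
  have hφlsc : LowerSemicontinuous φ := by
    refine LowerSemicontinuous.add' ?_ hlsc fun t => EReal.continuousAt_add ?_ ?_
    · exact (continuous_coe_real_ereal.comp (by fun_prop)).lowerSemicontinuous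
    · exact Or.inl (EReal.coe_ne_top _)
    · exact Or.inl (EReal.coe_ne_bot _)
  set B : ℝ := |a + 2 * c * (t₀ - z)| with hB
  -- Beyond distance `R` the quadratic term exceeds `(B + C + 1) |s - t₀|`. This absorbs the linear
  -- term (slope `B`) and the decay of `g` (slope `C`); the remaining `|s - t₀| ≥ 1` pays for the
  -- `-1` in the lower bound.
  set R : ℝ := (B + C + 1) / c + 1 with hR
  have hR1 : 1 ≤ R := by
    have : 0 ≤ (B + C + 1) / c := by positivity
    linarith
  obtain ⟨m, hm, hmin⟩ := (hφlsc.lowerSemicontinuousOn (Set.Icc (t₀ - R) (t₀ + R))).exists_isMinOn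
    ⟨t₀, by constructor <;> linarith⟩ isCompact_Icc
  have hmt : φ m ≤ φ t₀ := hmin (by constructor <;> linarith)
  refine ⟨m, fun s => ?_⟩
  change φ m ≤ φ s
  by_cases hs : s ∈ Set.Icc (t₀ - R) (t₀ + R)
  · exact hmin hs
  refine hmt.trans ?_
  have hsR : R < |s - t₀| := by
    by_contra hcon
    rw [not_lt, abs_le] at hcon
    exact hs ⟨by linarith, by linarith⟩
  refine le_trans ?_ (add_le_add_right (hC s) _)
  simp only [hφ]
  rw [← EReal.coe_toReal ht₀ (hbot t₀), EReal.toReal_coe, ← EReal.coe_add, ← EReal.coe_add,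
    EReal.coe_le_coe_iff]
  have h1 : -(B * |s - t₀|) ≤ (a + 2 * c * (t₀ - z)) * (s - t₀) := by
    rw [hB, ← abs_mul]; exact neg_abs_le _
  have h2 : B + C + 1 ≤ c * |s - t₀| := by
    have : (B + C + 1) / c ≤ |s - t₀| := by linarith
    rwa [div_le_iff₀ hc, mul_comm] at this
  have h3 : (B + C + 1) * |s - t₀| ≤ c * (s - t₀) ^ 2 := by
    rw [← sq_abs (s - t₀), sq, ← mul_assoc]
    exact mul_le_mul_of_nonneg_right h2 (abs_nonneg _)
  nlinarith

/-- The proximal inequality for a minimizer on the line. -/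
theorem prox_inequality (hbot : ∀ t, g t ≠ ⊥)
    (hconv : ConvexOn ℝ {t | g t ≠ ⊤} fun t => (g t).toReal) {t₀ : ℝ} (ht₀ : g t₀ ≠ ⊤)
    {a b z c m : ℝ}
    (hm : ∀ s, ((a * (m - b) + c * (m - z) ^ 2 : ℝ) : EReal) + g m ≤
      ((a * (s - b) + c * (s - z) ^ 2 : ℝ) : EReal) + g s) :
    g m ≠ ⊤ ∧ ∀ s, g s ≠ ⊤ →
      a * (m - b) + c * (m - z) ^ 2 + (g m).toReal + c * (s - m) ^ 2 ≤
        a * (s - b) + c * (s - z) ^ 2 + (g s).toReal := by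
  have hG : ∀ t, g t ≠ ⊤ → (((g t).toReal : ℝ) : EReal) = g t := fun t ht =>
    EReal.coe_toReal ht (hbot t)
  have hmtop : g m ≠ ⊤ := by
    intro htop
    have := hm t₀
    rw [htop, EReal.coe_add_top, ← hG t₀ ht₀, ← EReal.coe_add, top_le_iff] at this
    exact EReal.coe_ne_top _ this
  have hreal : ∀ s, g s ≠ ⊤ → a * (m - b) + c * (m - z) ^ 2 + (g m).toReal ≤
      a * (s - b) + c * (s - z) ^ 2 + (g s).toReal := by
    intro s hs
    have := hm s
    rwa [← hG m hmtop, ← hG s hs, ← EReal.coe_add, ← EReal.coe_add, EReal.coe_le_coe_iff] at this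
  refine ⟨hmtop, fun s hs => ?_⟩
  -- Compare `m` with `(1 - l) m + l s` and divide by `l`; the quadratic contributes the extra `c (1
  -- - l) (s - m) ^ 2`, and `l → 0` gives the claim.
  have hl : ∀ l : ℝ, 0 < l → l < 1 →
      a * (m - b) + c * (m - z) ^ 2 + (g m).toReal + c * (1 - l) * (s - m) ^ 2 ≤
        a * (s - b) + c * (s - z) ^ 2 + (g s).toReal := by
    intro l hl0 hl1
    have hcv := hconv.2 (x := m) (y := s) hmtop hs (sub_nonneg.2 hl1.le) hl0.le (by ring)
    have hdom := hconv.1 (x := m) (y := s) hmtop hs (sub_nonneg.2 hl1.le) hl0.le (by ring)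
    have h1 := hreal _ hdom
    simp only [smul_eq_mul] at hcv h1
    have h2 : 0 ≤ l * (a * (s - b) + c * (s - z) ^ 2 + (g s).toReal -
        (a * (m - b) + c * (m - z) ^ 2 + (g m).toReal + c * (1 - l) * (s - m) ^ 2)) := by
      nlinarith
    have := nonneg_of_mul_nonneg_right h2 hl0
    linarith
  have hlim : Filter.Tendsto (fun l : ℝ => a * (m - b) + c * (m - z) ^ 2 + (g m).toReal +
      c * (1 - l) * (s - m) ^ 2) (nhdsWithin 0 (Set.Ioi 0))
      (nhds (a * (m - b) + c * (m - z) ^ 2 + (g m).toReal + c * (1 - 0) * (s - m) ^ 2)) :=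
    (Continuous.tendsto (by fun_prop) 0).mono_left nhdsWithin_le_nhds
  have := le_of_tendsto hlim (by
    filter_upwards [Ioo_mem_nhdsGT (zero_lt_one (α := ℝ))] with l hl'
    exact hl l hl'.1 hl'.2)
  simpa using this

end OneDim

/-! ### The sequence `θ`, the coefficients `γ` and the averaging weights. -/

section Weights

variable {r θ₀ : ℝ}

theorem theta_pos (h : 0 < θ₀) : ∀ k, 0 < theta θ₀ k
  | 0 => h
  | k + 1 => by
    have hk := theta_pos h k
    rw [theta]
    have : theta θ₀ k ^ 2 < √(theta θ₀ k ^ 4 + 4 * theta θ₀ k ^ 2) := by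
      apply Real.lt_sqrt_of_sq_lt
      nlinarith [pow_pos hk 2]
    linarith

/-- The recursion selects the positive root of `t ^ 2 + θ_k ^ 2 t - θ_k ^ 2 = 0`; later estimates
use this equation instead of the square root. -/
theorem theta_succ_sq (θ₀ : ℝ) (k : ℕ) :
    theta θ₀ (k + 1) ^ 2 = (1 - theta θ₀ (k + 1)) * theta θ₀ k ^ 2 := by
  have h := Real.sq_sqrt (show 0 ≤ theta θ₀ k ^ 4 + 4 * theta θ₀ k ^ 2 by positivity)
  rw [theta]
  nlinarith

theorem theta_succ_lt_one (h : 0 < θ₀) (k : ℕ) : theta θ₀ (k + 1) < 1 := by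
  have h1 := theta_succ_sq θ₀ k
  have h2 := pow_pos (theta_pos h k) 2
  have h3 := pow_pos (theta_pos h (k + 1)) 2
  by_contra hcon
  nlinarith

theorem theta_succ_le (h : 0 < θ₀) (k : ℕ) : theta θ₀ (k + 1) ≤ theta θ₀ k := by
  have h1 := theta_succ_sq θ₀ k
  have h2 := pow_pos (theta_pos h k) 2
  have h3 := theta_pos h (k + 1)
  refine le_of_sq_le_sq ?_ (theta_pos h k).le
  nlinarith

theorem theta_le (h : 0 < θ₀) : ∀ k, theta θ₀ k ≤ θ₀
  | 0 => le_rfl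
  | k + 1 => (theta_succ_le h k).trans (theta_le h k)

/-- This is what makes the energies telescope: the gap coefficient entering step `k` equals the one
left by the preceding step. The convention at index `-1` makes it hold at `k = 0`. -/
theorem invSqPrev_eq (h : 0 < θ₀) (k : ℕ) :
    invSqPrev θ₀ k = (1 - theta θ₀ k) / theta θ₀ k ^ 2 := by
  cases k with
  | zero => rfl
  | succ k =>
    have h1 := (theta_pos h k).ne'
    have h2 := (theta_pos h (k + 1)).ne'
    rw [invSqPrev, div_eq_div_iff (by positivity) (by positivity), one_mul, theta_succ_sq]

theorem invSqPrev_nonneg (h : 0 < θ₀) (h1 : θ₀ ≤ 1) (k : ℕ) : 0 ≤ invSqPrev θ₀ k := by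
  rw [invSqPrev_eq h]
  exact div_nonneg (by linarith [theta_le h k]) (sq_nonneg _)

theorem gamma_self_succ (hr : r * θ₀ = 1) (k : ℕ) :
    gamma r θ₀ (k + 1) (k + 1) = r * theta θ₀ k := by
  cases k with
  | zero => simp [gamma, theta, hr]
  | succ k => simp [gamma]

/-- The combination `∑ i ≤ k, γ_k^i w_i`. -/
noncomputable def gammaSum {M : Type*} [AddCommGroup M] [Module ℝ M] (r θ₀ : ℝ) (w : ℕ → M)
    (k : ℕ) : M :=
  ∑ i ∈ range (k + 1), gamma r θ₀ k i • w i

theorem gammaSum_zero {M : Type*} [AddCommGroup M] [Module ℝ M] (w : ℕ → M) :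
    gammaSum r θ₀ w 0 = w 0 := by
  simp [gammaSum, gamma]

/-- The same recursion as that of `x_k`, written for an arbitrary sequence. It serves for the points
`z_i`, for the values `ψ(z_i)` and for constants. -/
theorem gammaSum_succ {M : Type*} [AddCommGroup M] [Module ℝ M] (hr : r * θ₀ = 1) (w : ℕ → M)
    (k : ℕ) :
    gammaSum r θ₀ w (k + 1) = (1 - theta θ₀ k) • gammaSum r θ₀ w k + theta θ₀ k • w k
      + (r * theta θ₀ k) • (w (k + 1) - w k) := by
  cases k with
  | zero =>
    simp only [gammaSum, gamma, sum_range_succ, range_zero, sum_empty, theta, hr]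
    simp only [zero_ne_one, if_true, if_false, zero_smul, one_smul,
      zero_add]
    module
  | succ k =>
    have h1 : ∀ i ∈ range (k + 1), gamma r θ₀ (k + 2) i • w i =
        (1 - theta θ₀ (k + 1)) • (gamma r θ₀ (k + 1) i • w i) := by
      intro i hi
      rw [mem_range] at hi
      rw [gamma, if_pos (by omega), mul_smul]
    have h2 : gamma r θ₀ (k + 2) (k + 1) =
        theta θ₀ (k + 1) * (1 - r * theta θ₀ k) + r * (theta θ₀ k - theta θ₀ (k + 1)) := by
      simp [gamma]
    rw [gammaSum, sum_range_succ, sum_range_succ, sum_congr rfl h1, ← smul_sum, h2,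
      gamma_self_succ hr, gammaSum, sum_range_succ _ (k + 1), gamma_self_succ hr]
    module

theorem sum_gamma (hr : r * θ₀ = 1) (k : ℕ) : ∑ i ∈ range (k + 1), gamma r θ₀ k i = 1 := by
  have h : ∀ k, gammaSum r θ₀ (fun _ => (1 : ℝ)) k = 1 := by
    intro k
    induction k with
    | zero => simp [gammaSum_zero]
    | succ k ih =>
      rw [gammaSum_succ hr, ih]
      simp
  simpa [gammaSum] using h k

theorem gamma_nonneg (hr : r * θ₀ = 1) (h : 0 < θ₀) (h1 : θ₀ ≤ 1) :
    ∀ k i, 0 ≤ gamma r θ₀ k i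
  | 0, i => by rw [gamma]; split_ifs <;> norm_num
  | 1, i => by rw [gamma]; split_ifs <;> norm_num
  | k + 2, i => by
    have hr0 : 0 < r := by
      by_contra hcon
      nlinarith
    have ha := theta_pos h k
    have hb := theta_pos h (k + 1)
    have hb1 := theta_succ_lt_one h k
    have hbθ := theta_le h (k + 1)
    rw [gamma]
    split_ifs
    · exact mul_nonneg (by linarith) (gamma_nonneg hr h h1 (k + 1) i)
    · have hsq := theta_succ_sq θ₀ k
      set a := theta θ₀ k
      set b := theta θ₀ (k + 1)
      -- The entry `γ_{k+2}^{k+1}` is the only one of unclear sign; multiplied by `a`, it is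
      -- nonnegative exactly under this bound. The bound holds since `b ^ 2 = (1 - b) a ^ 2` and `1
      -- - b ≥ 1 - θ₀ ≥ (1 - θ₀) ^ 2`.
      have hle : (1 - θ₀) * a ≤ b := by
        refine le_of_sq_le_sq ?_ hb.le
        rw [hsq, mul_pow]
        refine mul_le_mul_of_nonneg_right ?_ (sq_nonneg a)
        nlinarith
      have h2 : 0 ≤ a * (b * (1 - r * a) + r * (a - b)) := by
        have : a * (b * (1 - r * a) + r * (a - b)) = r * b * (b - (1 - θ₀) * a) := by
          linear_combination (-r) * hsq + (-(a * b)) * hr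
        rw [this]
        exact mul_nonneg (by positivity) (by linarith)
      exact nonneg_of_mul_nonneg_right h2 ha
    · positivity
    · exact le_rfl

theorem headWeight_nonneg (hr : r * θ₀ = 1) (h : 0 < θ₀) (h1 : θ₀ ≤ 1) (k i : ℕ) :
    0 ≤ headWeight r θ₀ k i :=
  mul_nonneg (gamma_nonneg hr h h1 k i) (invSqPrev_nonneg h h1 i)

/-- Since `θ_{k-1} ≤ θ₀`, the weight is at least `1 / θ₀`. At `k = 0` the truncated subtraction
reads `θ₀`, so the bound survives. -/
theorem lastWeight_pos (h : 0 < θ₀) (k : ℕ) : 0 < lastWeight θ₀ k := by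
  have h1 := theta_pos h (k - 1)
  have h2 : 1 / θ₀ ^ 2 ≤ 1 / (θ₀ * theta θ₀ (k - 1)) := by
    apply one_div_le_one_div_of_le (by positivity)
    nlinarith [theta_le h (k - 1)]
  have h3 : 1 / θ₀ ^ 2 - (1 - θ₀) / θ₀ ^ 2 = 1 / θ₀ := by field_simp; ring
  have h4 : 0 < 1 / θ₀ := by positivity
  rw [lastWeight]
  linarith

theorem totalWeight_pos (hr : r * θ₀ = 1) (h : 0 < θ₀) (h1 : θ₀ ≤ 1) (k : ℕ) :
    0 < totalWeight r θ₀ k :=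
  add_pos_of_nonneg_of_pos (sum_nonneg fun i _ => headWeight_nonneg hr h h1 k i)
    (lastWeight_pos h k)

/-- The weight of `x_k`, rewritten through the diagonal coefficient `γ_k^k`. -/
theorem lastWeight_add (hr : r * θ₀ = 1) (h : 0 < θ₀) {k : ℕ} (hk : 1 ≤ k) :
    lastWeight θ₀ k + (1 - θ₀) / θ₀ ^ 2 = headWeight r θ₀ k k := by
  obtain ⟨k, rfl⟩ := Nat.exists_eq_add_of_le' hk
  have h1 := (theta_pos h k).ne'
  have h2 : r = 1 / θ₀ := by rw [eq_div_iff h.ne', hr]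
  rw [lastWeight, headWeight, gamma_self_succ hr, invSqPrev, Nat.add_sub_cancel, h2]
  field_simp
  ring

end Weights

/-! ### Expectations under the law of the random subset. -/

section SampleMean

variable {n : ℕ} (p : PMF (Finset (Fin n)))

theorem sampleMean_mono {g h : Finset (Fin n) → ℝ} (H : ∀ A, g A ≤ h A) :
    sampleMean p g ≤ sampleMean p h :=
  sum_le_sum fun A _ => mul_le_mul_of_nonneg_left (H A) ENNReal.toReal_nonneg

theorem sampleMean_add (g h : Finset (Fin n) → ℝ) :
    sampleMean p (fun A => g A + h A) = sampleMean p g + sampleMean p h := by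
  simp only [sampleMean, mul_add, sum_add_distrib]

theorem sampleMean_const_mul (c : ℝ) (g : Finset (Fin n) → ℝ) :
    sampleMean p (fun A => c * g A) = c * sampleMean p g := by
  simp only [sampleMean, mul_sum]
  exact sum_congr rfl fun A _ => by ring

theorem sampleMean_const (c : ℝ) : sampleMean p (fun _ => c) = c := by
  have h : ∑ A, (p A).toReal = 1 := by
    have h1 := p.tsum_coe
    rw [tsum_fintype] at h1
    rw [← ENNReal.toReal_sum fun A _ => p.apply_ne_top A, h1, ENNReal.toReal_one]
  rw [sampleMean, ← sum_mul, h, one_mul]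

theorem sampleMean_sum {ι : Type*} (s : Finset ι) (g : ι → Finset (Fin n) → ℝ) :
    sampleMean p (fun A => ∑ i ∈ s, g i A) = ∑ i ∈ s, sampleMean p (g i) := by
  simp only [sampleMean, mul_sum]
  exact sum_comm

theorem sum_inclusionProb : ∑ i, inclusionProb p i = meanSize p := by
  simp only [inclusionProb, meanSize]
  rw [← sampleMean_sum]
  congr 1
  ext A
  simp

theorem inclusionProb_eq_div (hp : ∀ i j, inclusionProb p i = inclusionProb p j) (i : Fin n) :
    inclusionProb p i = meanSize p / n := by
  have hn : (n : ℝ) ≠ 0 := by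
    have := i.pos
    positivity
  rw [eq_div_iff hn, ← sum_inclusionProb, sum_congr rfl fun j _ => hp j i]
  simp [mul_comm]

theorem meanSize_le : meanSize p ≤ n := by
  rw [← sampleMean_const p (n : ℝ)]
  refine sampleMean_mono p fun A => ?_
  exact_mod_cast (card_le_univ A).trans_eq (Fintype.card_fin n)

/-- Expectation of a separable function of a vector whose coordinates in a uniform random set are
replaced. -/
theorem sampleMean_sum_ite (hp : ∀ i j, inclusionProb p i = inclusionProb p j)
    (a b : Fin n → ℝ) :
    sampleMean p (fun A => ∑ i, if i ∈ A then a i else b i) =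
      ∑ i, b i + meanSize p / n * (∑ i, a i - ∑ i, b i) := by
  have h1 : ∀ i, sampleMean p (fun A => if i ∈ A then a i else b i) =
      b i + meanSize p / n * (a i - b i) := by
    intro i
    have h2 : (fun A : Finset (Fin n) => if i ∈ A then a i else b i) =
        fun A => b i + (a i - b i) * (if i ∈ A then 1 else 0) := by
      ext A
      split_ifs <;> ring
    rw [h2, sampleMean_add, sampleMean_const, sampleMean_const_mul]
    change b i + (a i - b i) * inclusionProb p i = _
    rw [inclusionProb_eq_div p hp]
    ring
  rw [sampleMean_sum, sum_congr rfl fun i _ => h1 i, sum_add_distrib, ← mul_sum,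
    sum_sub_distrib]

end SampleMean

/-! ### Integration along the independent samples. -/

section Independence

variable {n : ℕ} {Ω : Type*} [MeasurableSpace Ω] {P : Measure Ω} [IsProbabilityMeasure P]
  {S : ℕ → Ω → Finset (Fin n)}

theorem measurable_of_singletons {α : Type*} [Finite α] {X : Ω → α}
    (hX : ∀ a, MeasurableSet (X ⁻¹' {a})) : Measurable[_, ⊤] X := by
  let : MeasurableSpace α := ⊤
  exact measurable_to_countable' hX

/-- Such a function factors through the first `k` samples, which take finitely many values. -/
theorem integrable_of_dependsOn (hS : ∀ k A, MeasurableSet (S k ⁻¹' {A}))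
    {k : ℕ} {g : (ℕ → Finset (Fin n)) → ℝ} (hg : DependsOn g (range k)) :
    Integrable (fun ω => g fun l => S l ω) P := by
  let : MeasurableSpace (Finset (Fin n)) := ⊤
  have : MeasurableSingletonClass (Finset (Fin n)) := ⟨fun _ => trivial⟩
  obtain ⟨G, rfl⟩ := dependsOn_iff_exists_comp.1 hg
  have hm : Measurable fun ω (i : (range k : Set ℕ)) => S i ω :=
    measurable_pi_lambda _ fun i => measurable_of_singletons (hS i)
  have : Finite (range k : Set ℕ) := (range k).finite_toSet
  exact (Integrable.of_finite (μ := P.map fun ω (i : (range k : Set ℕ)) => S i ω)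
    (f := G)).comp_measurable hm

/-- One step of a supermartingale argument along an independent sequence of random sets. -/
theorem integral_le_of_sampleMean_update_le {p : PMF (Finset (Fin n))}
    (hS : ∀ k A, MeasurableSet (S k ⁻¹' {A})) (hlaw : ∀ k A, P (S k ⁻¹' {A}) = p A)
    (hind : iIndepFun (m := fun _ => ⊤) S P) {k : ℕ} {g h : (ℕ → Finset (Fin n)) → ℝ}
    (hg : DependsOn g (range k)) (hh : DependsOn h (range (k + 1)))
    (H : ∀ A, sampleMean p (fun B => h (Function.update A k B)) ≤ g A) :
    ∫ ω, h (fun l => S l ω) ∂P ≤ ∫ ω, g (fun l => S l ω) ∂P := by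
  let : MeasurableSpace (Finset (Fin n)) := ⊤
  have : MeasurableSingletonClass (Finset (Fin n)) := ⟨fun _ => trivial⟩
  have hmS : ∀ k, Measurable (S k) := fun k => measurable_of_singletons (hS k)
  set T : Ω → (range k → Finset (Fin n)) := fun ω i => S i ω with hT
  have hmT : Measurable T := measurable_pi_lambda _ fun i => hmS i
  have hTS : IndepFun T (S k) P := by
    have h1 := hind.indepFun_finset (range k) {k} (by simp) hmS
    exact h1.comp (φ := id) (ψ := fun u : (({k} : Finset ℕ) → Finset (Fin n)) =>
      u ⟨k, mem_singleton_self k⟩) measurable_id (measurable_pi_apply _)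
  have hSk : P.map (S k) = p.toMeasure := by
    refine Measure.ext_of_singleton fun A => ?_
    rw [Measure.map_apply (hmS k) (measurableSet_singleton A), hlaw,
      p.toMeasure_apply_singleton A (measurableSet_singleton A)]
  -- The filler `∅` is immaterial: `g` reads only indices below `k`, and `h` additionally reads
  -- index `k`, which the update supplies.
  let ext : (range k → Finset (Fin n)) → ℕ → Finset (Fin n) := fun t l =>
    if hl : l ∈ range k then t ⟨l, hl⟩ else ∅
  have h_eq : ∀ ω, h (fun l => S l ω) = h (Function.update (ext (T ω)) k (S k ω)) := by
    intro ω
    refine hh fun l hl => ?_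
    rcases eq_or_ne l k with rfl | hne
    · simp
    · have : l < k := by
        have := mem_range.1 (mem_coe.1 hl)
        omega
      simp [ext, Function.update_of_ne hne, this, hT]
  have g_eq : ∀ ω, g (fun l => S l ω) = g (ext (T ω)) := by
    intro ω
    refine hg fun l hl => ?_
    have : l < k := mem_range.1 (mem_coe.1 hl)
    simp [ext, this, hT]
  have : IsProbabilityMeasure (P.map T) := Measure.isProbabilityMeasure_map hmT.aemeasurable
  calc ∫ ω, h (fun l => S l ω) ∂P
      = ∫ ω, h (Function.update (ext (T ω)) k (S k ω)) ∂P := integral_congr_ae (.of_forall h_eq)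
    _ = ∫ q, h (Function.update (ext q.1) k q.2) ∂(P.map fun ω => (T ω, S k ω)) :=
        (integral_map (f := fun q : (range k → Finset (Fin n)) × Finset (Fin n) =>
          h (Function.update (ext q.1) k q.2)) (hmT.prodMk (hmS k)).aemeasurable
          (Measurable.of_discrete.aestronglyMeasurable)).symm
    _ = ∫ q, h (Function.update (ext q.1) k q.2) ∂((P.map T).prod p.toMeasure) := by
        rw [(indepFun_iff_map_prod_eq_prod_map_map hmT.aemeasurable (hmS k).aemeasurable).1 hTS,
          hSk]
    _ = ∫ t, ∫ B, h (Function.update (ext t) k B) ∂p.toMeasure ∂(P.map T) :=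
        integral_prod _ Integrable.of_finite
    _ ≤ ∫ t, g (ext t) ∂(P.map T) := by
        refine integral_mono Integrable.of_finite Integrable.of_finite fun t => ?_
        simp only [PMF.integral_eq_sum, smul_eq_mul]
        exact H (ext t)
    _ = ∫ ω, g (ext (T ω)) ∂P :=
        integral_map hmT.aemeasurable (Measurable.of_discrete.aestronglyMeasurable)
    _ = ∫ ω, g (fun l => S l ω) ∂P := integral_congr_ae (.of_forall fun ω => (g_eq ω).symm)

end Independence

/-! ### The domain of `ψ` and properties inherited by its coordinates. -/

section Domain

variable {n : ℕ} {ψ : Fin n → ℝ → EReal}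

/-- The domain of the separable function `x ↦ ∑ i, ψ i (x i)`. -/
def dom (ψ : Fin n → ℝ → EReal) : Set (EuclideanSpace ℝ (Fin n)) :=
  {x | ∀ i, ψ i (x i) ≠ ⊤}

/-- The real value of `∑ i, ψ i (x i)`, for `x ∈ dom ψ`. -/
noncomputable def sepReal (ψ : Fin n → ℝ → EReal) (x : EuclideanSpace ℝ (Fin n)) : ℝ :=
  ∑ i, (ψ i (x i)).toReal

theorem coe_sum {ι : Type*} (s : Finset ι) (a : ι → ℝ) :
    ((∑ i ∈ s, a i : ℝ) : EReal) = ∑ i ∈ s, (a i : EReal) := by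
  classical
  induction s using Finset.induction_on with
  | empty => simp
  | insert i s hi ih => rw [sum_insert hi, sum_insert hi, EReal.coe_add, ih]

theorem separable_eq_coe (hbot : ∀ i t, ψ i t ≠ ⊥) {x : EuclideanSpace ℝ (Fin n)}
    (hx : x ∈ dom ψ) : separable ψ x = (sepReal ψ x : ℝ) := by
  rw [separable, sepReal, coe_sum]
  exact sum_congr rfl fun i _ => (EReal.coe_toReal (hx i) (hbot i _)).symm

theorem sum_ne_bot {ι : Type*} (s : Finset ι) {a : ι → EReal} (ha : ∀ i, a i ≠ ⊥) :
    ∑ i ∈ s, a i ≠ ⊥ := by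
  classical
  induction s using Finset.induction_on with
  | empty => simp
  | insert i s hi ih =>
    rw [sum_insert hi]
    exact EReal.add_ne_bot_iff.2 ⟨ha i, ih⟩

theorem mem_dom_of_separable_ne_top (hbot : ∀ i t, ψ i t ≠ ⊥) {x : EuclideanSpace ℝ (Fin n)}
    (hx : separable ψ x ≠ ⊤) : x ∈ dom ψ := by
  intro i hi
  apply hx
  rw [separable, ← add_sum_erase _ _ (mem_univ i), hi]
  exact EReal.top_add_of_ne_bot (sum_ne_bot _ fun j => hbot j _)

theorem objective_eq_coe (f : EuclideanSpace ℝ (Fin n) → ℝ) (hbot : ∀ i t, ψ i t ≠ ⊥)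
    {x : EuclideanSpace ℝ (Fin n)} (hx : x ∈ dom ψ) :
    objective f ψ x = ((f x + sepReal ψ x : ℝ) : EReal) := by
  rw [objective, separable_eq_coe hbot hx, EReal.coe_add]

theorem convexOn_sepReal (hbot : ∀ i t, ψ i t ≠ ⊥) (hψ : IsClosedConvex (separable ψ)) :
    ConvexOn ℝ (dom ψ) (sepReal ψ) := by
  have key : ∀ ⦃x⦄, x ∈ dom ψ → ∀ ⦃y⦄, y ∈ dom ψ → ∀ ⦃a b : ℝ⦄, 0 ≤ a → 0 ≤ b → a + b = 1 →
      separable ψ (a • x + b • y) ≤ ((a • sepReal ψ x + b • sepReal ψ y : ℝ) : EReal) := by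
    intro x hx y hy a b ha hb hab
    exact hψ.1 (x := (x, sepReal ψ x)) (separable_eq_coe hbot hx).le
      (y := (y, sepReal ψ y)) (separable_eq_coe hbot hy).le ha hb hab
  have hdom : Convex ℝ (dom ψ) := fun x hx y hy a b ha hb hab =>
    mem_dom_of_separable_ne_top hbot ((key hx hy ha hb hab).trans_lt (EReal.coe_lt_top _)).ne
  refine ⟨hdom, fun x hx y hy a b ha hb hab => ?_⟩
  have h := key hx hy ha hb hab
  rwa [separable_eq_coe hbot (hdom hx hy ha hb hab), EReal.coe_le_coe_iff] at h

/-- The vector `x` with its `i`-th coordinate replaced by `t`. -/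
noncomputable def replace (x : EuclideanSpace ℝ (Fin n)) (i : Fin n) (t : ℝ) :
    EuclideanSpace ℝ (Fin n) :=
  WithLp.toLp 2 (Function.update x i t)

theorem replace_self (x : EuclideanSpace ℝ (Fin n)) (i : Fin n) (t : ℝ) :
    replace x i t i = t := by
  simp [replace]

theorem replace_of_ne (x : EuclideanSpace ℝ (Fin n)) {i j : Fin n} (h : j ≠ i) (t : ℝ) :
    replace x i t j = x j := by
  simp [replace, h]

theorem replace_mem_dom {x : EuclideanSpace ℝ (Fin n)} (hx : x ∈ dom ψ) {i : Fin n} {t : ℝ}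
    (ht : ψ i t ≠ ⊤) : replace x i t ∈ dom ψ := by
  intro j
  rcases eq_or_ne j i with rfl | hj
  · rwa [replace_self]
  · rw [replace_of_ne x hj]
    exact hx j

theorem sepReal_replace (ψ : Fin n → ℝ → EReal) (x : EuclideanSpace ℝ (Fin n)) (i : Fin n)
    (t : ℝ) : sepReal ψ (replace x i t) =
      (ψ i t).toReal + ∑ j ∈ univ.erase i, (ψ j (x j)).toReal := by
  rw [sepReal, ← add_sum_erase _ _ (mem_univ i), replace_self]
  congr 1
  exact sum_congr rfl fun j hj => by rw [replace_of_ne x (ne_of_mem_erase hj)]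

/-- Closed convexity is known only for the separable sum. Freezing the other coordinates at a point
of the domain leaves `ψ i` plus a finite constant. -/
theorem convexOn_coordinate (hbot : ∀ i t, ψ i t ≠ ⊥) (hψ : IsClosedConvex (separable ψ))
    {x : EuclideanSpace ℝ (Fin n)} (hx : x ∈ dom ψ) (i : Fin n) :
    ConvexOn ℝ {t | ψ i t ≠ ⊤} fun t => (ψ i t).toReal := by
  have hcv := convexOn_sepReal hbot hψ
  have hcomb : ∀ (s t a b : ℝ), a + b = 1 →
      a • replace x i s + b • replace x i t = replace x i (a • s + b • t) := by
    intro s t a b hab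
    ext j
    rcases eq_or_ne j i with rfl | hj
    · simp [replace_self]
    · simp only [PiLp.add_apply, PiLp.smul_apply, replace_of_ne x hj, ← add_smul, hab, one_smul]
  refine ⟨fun s hs t ht a b ha hb hab => ?_, fun s hs t ht a b ha hb hab => ?_⟩
  · have h := hcv.1 (replace_mem_dom hx hs) (replace_mem_dom hx ht) ha hb hab i
    rwa [hcomb s t a b hab, replace_self] at h
  · have h := hcv.2 (replace_mem_dom hx hs) (replace_mem_dom hx ht) ha hb hab
    rw [hcomb s t a b hab] at h
    simp only [sepReal_replace, smul_eq_mul] at h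
    simp only [smul_eq_mul]
    have hc : ∀ c : ℝ, a * c + b * c = c := fun c => by rw [← add_mul, hab, one_mul]
    linarith [hc (∑ j ∈ univ.erase i, (ψ j (x j)).toReal)]

theorem lowerSemicontinuous_coordinate (hbot : ∀ i t, ψ i t ≠ ⊥)
    (hψ : IsClosedConvex (separable ψ)) {x : EuclideanSpace ℝ (Fin n)} (hx : x ∈ dom ψ)
    (i : Fin n) : LowerSemicontinuous (ψ i) := by
  set c : ℝ := ∑ j ∈ univ.erase i, (ψ j (x j)).toReal with hc
  have hcont : Continuous (replace x i) :=
    (PiLp.continuous_toLp 2 _).comp (continuous_const.update i continuous_id)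
  have h1 : LowerSemicontinuous fun t => separable ψ (replace x i t) := hψ.2.comp hcont
  have h2 : ∀ t, separable ψ (replace x i t) = ψ i t + (c : EReal) := by
    intro t
    rw [separable, ← add_sum_erase _ _ (mem_univ i), replace_self, hc, coe_sum]
    congr 1
    refine sum_congr rfl fun j hj => ?_
    rw [replace_of_ne x (ne_of_mem_erase hj), EReal.coe_toReal (hx j) (hbot j _)]
  have h3 : LowerSemicontinuous fun t => separable ψ (replace x i t) + ((-c : ℝ) : EReal) :=
    h1.add' lowerSemicontinuous_const fun t =>
      EReal.continuousAt_add (Or.inr (EReal.coe_ne_bot _)) (Or.inr (EReal.coe_ne_top _))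
  convert h3 using 2 with t
  rw [h2, add_assoc, ← EReal.coe_add, add_neg_cancel, EReal.coe_zero, add_zero]

end Domain

/-! ### One step of APPROX in expectation. -/

section Step

variable {n : ℕ} {f : EuclideanSpace ℝ (Fin n) → ℝ} {ψ : Fin n → ℝ → EReal} {v : Fin n → ℝ}

/-- The sampled update is the deterministic full update read on the coordinates in `A`. All
expectations over `A` therefore reduce to one vector, `zUpdate ... univ`. -/
theorem zUpdate_apply (f : EuclideanSpace ℝ (Fin n) → ℝ) (ψ : Fin n → ℝ → EReal)
    (v : Fin n → ℝ) (τ θ : ℝ) (A : Finset (Fin n)) (x z : EuclideanSpace ℝ (Fin n))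
    (i : Fin n) : zUpdate f ψ v τ θ A x z i =
      if i ∈ A then zUpdate f ψ v τ θ univ x z i else z i := by
  simp [zUpdate]

theorem zUpdate_univ_prox (hbot : ∀ i t, ψ i t ≠ ⊥) (hψ : IsClosedConvex (separable ψ))
    (hv : ∀ i, 0 < v i) {τ θ : ℝ} (hτ : 0 < τ) (hθ : 0 < θ)
    (x : EuclideanSpace ℝ (Fin n)) {z : EuclideanSpace ℝ (Fin n)} (hz : z ∈ dom ψ) (i : Fin n) :
    let m := zUpdate f ψ v τ θ univ x z i
    let a := gradient f (yPoint θ x z) i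
    let c := θ * n * v i / (2 * τ)
    ψ i m ≠ ⊤ ∧ ∀ s, ψ i s ≠ ⊤ →
      a * (m - yPoint θ x z i) + c * (m - z i) ^ 2 + (ψ i m).toReal + c * (s - m) ^ 2 ≤
        a * (s - yPoint θ x z i) + c * (s - z i) ^ 2 + (ψ i s).toReal := by
  intro m a c
  have hn : (0 : ℝ) < n := by exact_mod_cast i.pos
  have hc : 0 < c := by have := hv i; positivity
  have hcv := convexOn_coordinate hbot hψ hz i
  refine prox_inequality (hbot i) hcv (hz i) ?_
  have hex := exists_prox (lowerSemicontinuous_coordinate hbot hψ hz i) (hbot i) hcv (hz i) a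
    (yPoint θ x z i) (z i) hc
  have hm : m = argmin fun t =>
      ((a * (t - yPoint θ x z i) + c * (t - z i) ^ 2 : ℝ) : EReal) + ψ i t := by
    simp [m, zUpdate, a, c]
  rw [hm]
  exact Classical.epsilon_spec (p := fun t => ∀ s,
    ((a * (t - yPoint θ x z i) + c * (t - z i) ^ 2 : ℝ) : EReal) + ψ i t ≤
      ((a * (s - yPoint θ x z i) + c * (s - z i) ^ 2 : ℝ) : EReal) + ψ i s) hex

theorem zUpdate_mem_dom (hbot : ∀ i t, ψ i t ≠ ⊥) (hψ : IsClosedConvex (separable ψ))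
    (hv : ∀ i, 0 < v i) {τ θ : ℝ} (hτ : 0 < τ) (hθ : 0 < θ) (A : Finset (Fin n))
    (x : EuclideanSpace ℝ (Fin n)) {z : EuclideanSpace ℝ (Fin n)} (hz : z ∈ dom ψ) :
    zUpdate f ψ v τ θ A x z ∈ dom ψ := by
  intro i
  rw [zUpdate_apply]
  split_ifs
  · exact (zUpdate_univ_prox hbot hψ hv hτ hθ x hz i).1
  · exact hz i

/-- The proximal inequality for the full update, tested at `u`. -/
theorem zUpdate_univ_inequality (hbot : ∀ i t, ψ i t ≠ ⊥) (hψ : IsClosedConvex (separable ψ))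
    (hv : ∀ i, 0 < v i) {τ θ : ℝ} (hτ : 0 < τ) (hθ : 0 < θ)
    (x : EuclideanSpace ℝ (Fin n)) {z u : EuclideanSpace ℝ (Fin n)} (hz : z ∈ dom ψ)
    (hu : u ∈ dom ψ) :
    let y := yPoint θ x z
    let zh := zUpdate f ψ v τ θ univ x z
    inner ℝ (gradient f y) (zh - y) + n / τ * θ / 2 * wnormSq v (zh - z) + sepReal ψ zh
        + n / τ * θ / 2 * wnormSq v (zh - u) ≤
      inner ℝ (gradient f y) (u - y) + n / τ * θ / 2 * wnormSq v (z - u) + sepReal ψ u := by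
  intro y zh
  have hinner : ∀ a b : EuclideanSpace ℝ (Fin n), inner ℝ a b = ∑ i, a i * b i := by
    intro a b
    rw [PiLp.inner_apply]
    exact sum_congr rfl fun i _ => by simp [mul_comm]
  rw [hinner, hinner]
  simp only [wnormSq, sepReal, mul_sum, ← sum_add_distrib]
  refine sum_le_sum fun i _ => ?_
  have h := (zUpdate_univ_prox (f := f) hbot hψ hv hτ hθ x hz i).2 (u i) (hu i)
  have hc : θ * n * v i / (2 * τ) = n / τ * θ / 2 * v i := by field_simp
  rw [hc] at h
  simp only [PiLp.sub_apply, y, zh]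
  exact le_of_eq_of_le (by ring) (h.trans_eq (by ring))

/-- The expected decrease of the Lyapunov function in one step of APPROX. -/
theorem sampleMean_step_le (hf_diff : Differentiable ℝ f) (hf_conv : ConvexOn ℝ Set.univ f)
    (hbot : ∀ i t, ψ i t ≠ ⊥) (hψ : IsClosedConvex (separable ψ)) (hv : ∀ i, 0 < v i)
    {p : PMF (Finset (Fin n))} (hp : ∀ i j, inclusionProb p i = inclusionProb p j)
    (hp_pos : 0 < meanSize p) (heso : ESO f p v) {θ : ℝ} (hθ : 0 < θ) (hθ1 : θ ≤ 1)
    (x : EuclideanSpace ℝ (Fin n)) {z u : EuclideanSpace ℝ (Fin n)} (hz : z ∈ dom ψ)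
    (hu : u ∈ dom ψ) (c : ℝ) :
    let r := n / meanSize p
    let y := yPoint θ x z
    let z' := fun B => zUpdate f ψ v (meanSize p) θ B x z
    sampleMean p (fun B => 1 / θ ^ 2 * (f (y + (r * θ) • (z' B - z))
        + ((1 - θ) * c + θ * sepReal ψ z + r * θ * (sepReal ψ (z' B) - sepReal ψ z))
        - (f u + sepReal ψ u)) + r ^ 2 / 2 * wnormSq v (z' B - u)) ≤
      (1 - θ) / θ ^ 2 * (f x + c - (f u + sepReal ψ u)) + r ^ 2 / 2 * wnormSq v (z - u) := by
  intro r y z'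
  have hn : (0 : ℝ) < n := hp_pos.trans_le (meanSize_le p)
  have hr : 0 < r := div_pos hn hp_pos
  have hr' : meanSize p / n = 1 / r := by rw [one_div_div]
  set zh := zUpdate f ψ v (meanSize p) θ univ x z with hzh
  -- The ESO is applied along `rθ (zh - z)`, whose restriction to `B` is the actual move of `x`.
  have e1 : sampleMean p (fun B => f (y + (r * θ) • (z' B - z))) ≤
      f y + θ * inner ℝ (gradient f y) (zh - z) + r * θ ^ 2 / 2 * wnormSq v (zh - z) := by
    have h := heso y ((r * θ) • (zh - z))
    have h1 : ∀ B, restrictTo ((r * θ) • (zh - z)) B = (r * θ) • (z' B - z) := by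
      intro B
      ext i
      simp only [restrictTo, PiLp.smul_apply, PiLp.sub_apply, z', zUpdate_apply _ _ _ _ _ B]
      split_ifs <;> simp [hzh]
    have h2 : wnormSq v ((r * θ) • (zh - z)) = (r * θ) ^ 2 * wnormSq v (zh - z) := by
      simp only [wnormSq, mul_sum, PiLp.smul_apply, smul_eq_mul]
      exact sum_congr rfl fun i _ => by ring
    simp only [h1] at h
    rw [h2, inner_smul_right, hr'] at h
    refine h.trans_eq ?_
    field_simp
    ring
  have e2 : sampleMean p (fun B => sepReal ψ (z' B)) =
      sepReal ψ z + 1 / r * (sepReal ψ zh - sepReal ψ z) := by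
    have h := sampleMean_sum_ite p hp (fun i => (ψ i (zh i)).toReal) fun i => (ψ i (z i)).toReal
    rw [hr'] at h
    rw [← sepReal, ← sepReal] at h
    rw [← h]
    congr 1
    ext B
    rw [sepReal]
    refine sum_congr rfl fun i _ => ?_
    simp only [z', zUpdate_apply _ _ _ _ _ B]
    split_ifs <;> rfl
  have e3 : sampleMean p (fun B => wnormSq v (z' B - u)) =
      wnormSq v (z - u) + 1 / r * (wnormSq v (zh - u) - wnormSq v (z - u)) := by
    have h := sampleMean_sum_ite p hp (fun i => v i * ((zh - u) i) ^ 2)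
      fun i => v i * ((z - u) i) ^ 2
    rw [hr'] at h
    rw [← wnormSq, ← wnormSq] at h
    rw [← h]
    congr 1
    ext B
    rw [wnormSq]
    refine sum_congr rfl fun i _ => ?_
    simp only [z', PiLp.sub_apply, zUpdate_apply _ _ _ _ _ B]
    split_ifs <;> rfl
  have e4 := zUpdate_univ_inequality (f := f) hbot hψ hv hp_pos hθ x hz hu
  have e5 := add_inner_gradient_le hf_diff hf_conv x y
  have e6 := add_inner_gradient_le hf_diff hf_conv u y
  -- As `y = (1 - θ) x + θ z`, one has `θ (zh - z) = θ (zh - y) + (1 - θ) (x - y)`: the first part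
  -- meets the proximal inequality, the second convexity at `x`.
  have e7 : θ * inner ℝ (gradient f y) (zh - z) =
      θ * inner ℝ (gradient f y) (zh - y) + (1 - θ) * inner ℝ (gradient f y) (x - y) := by
    rw [← inner_smul_right, ← inner_smul_right, ← inner_smul_right, ← inner_add_right]
    congr 1
    simp only [y, yPoint]
    module
  have e8 : (fun B => 1 / θ ^ 2 * (f (y + (r * θ) • (z' B - z))
        + ((1 - θ) * c + θ * sepReal ψ z + r * θ * (sepReal ψ (z' B) - sepReal ψ z))
        - (f u + sepReal ψ u)) + r ^ 2 / 2 * wnormSq v (z' B - u)) =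
      fun B => 1 / θ ^ 2 * f (y + (r * θ) • (z' B - z)) + (r / θ * sepReal ψ (z' B)
        + (r ^ 2 / 2 * wnormSq v (z' B - u) + 1 / θ ^ 2 * ((1 - θ) * c + θ * sepReal ψ z
          - r * θ * sepReal ψ z - (f u + sepReal ψ u)))) := by
    ext B
    field_simp
    ring
  rw [e8]
  simp only [sampleMean_add, sampleMean_const_mul, sampleMean_const, e2, e3]
  change inner ℝ (gradient f y) (zh - y) + r * θ / 2 * wnormSq v (zh - z) + sepReal ψ zh
        + r * θ / 2 * wnormSq v (zh - u) ≤
      inner ℝ (gradient f y) (u - y) + r * θ / 2 * wnormSq v (z - u) + sepReal ψ u at e4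
  set X := sampleMean p (fun B => f (y + (r * θ) • (z' B - z)))
  -- The ESO term in `‖zh - z‖_v^2` cancels against `θ` times the one in the proximal inequality;
  -- this fixes the proximal stepsize.
  have e9 : X + θ * sepReal ψ zh + r * θ ^ 2 / 2 * wnormSq v (zh - u) ≤
      (1 - θ) * f x + θ * (f u + sepReal ψ u) + r * θ ^ 2 / 2 * wnormSq v (z - u) := by
    have h4 := mul_le_mul_of_nonneg_left e4 hθ.le
    have h5 := mul_le_mul_of_nonneg_left e5 (sub_nonneg.2 hθ1)
    have h6 := mul_le_mul_of_nonneg_left e6 hθ.le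
    nlinarith
  have e10 := mul_le_mul_of_nonneg_left e9 (show 0 ≤ 1 / θ ^ 2 by positivity)
  rw [← sub_nonneg] at e10 ⊢
  refine e10.trans_eq ?_
  field_simp
  ring

end Step

/-! ### Convexity of the weighted norm and Jensen at the averaged point. -/

section Convexity

variable {n : ℕ} {v : Fin n → ℝ}

theorem wnormSq_nonneg (hv : ∀ i, 0 < v i) (x : EuclideanSpace ℝ (Fin n)) :
    0 ≤ wnormSq v x :=
  sum_nonneg fun i _ => mul_nonneg (hv i).le (sq_nonneg _)

theorem convexOn_wnormSq_sub (hv : ∀ i, 0 < v i) (u : EuclideanSpace ℝ (Fin n)) :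
    ConvexOn ℝ Set.univ fun x => wnormSq v (x - u) := by
  refine ⟨convex_univ, fun x _ y _ a b ha hb hab => ?_⟩
  simp only [wnormSq, smul_eq_mul, mul_sum, ← sum_add_distrib]
  refine sum_le_sum fun i _ => ?_
  simp only [PiLp.sub_apply, PiLp.add_apply, PiLp.smul_apply, smul_eq_mul]
  obtain rfl : b = 1 - a := by linarith
  have h : 0 ≤ a * (1 - a) * (v i * (x i - y i) ^ 2) :=
    mul_nonneg (mul_nonneg ha hb) (mul_nonneg (hv i).le (sq_nonneg _))
  nlinarith

theorem ringPoint_eq_centerMass (r θ₀ : ℝ) (x : ℕ → EuclideanSpace ℝ (Fin n)) (k : ℕ) :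
    ringPoint r θ₀ x k = (range (k + 1)).centerMass
      (fun i => if i < k then headWeight r θ₀ k i else lastWeight θ₀ k) x := by
  have h : ∀ i ∈ range k, (if i < k then headWeight r θ₀ k i else lastWeight θ₀ k) =
      headWeight r θ₀ k i := fun i hi => if_pos (mem_range.1 hi)
  rw [ringPoint, centerMass, sum_range_succ, sum_range_succ, sum_congr rfl h, if_neg (lt_irrefl k),
    one_div, totalWeight]
  congr 2
  exact sum_congr rfl fun i hi => by rw [h i hi]

/-- Jensen's inequality for the averaged point. -/
theorem ringPoint_mem_and_le {r θ₀ : ℝ} (hr : r * θ₀ = 1) (h : 0 < θ₀) (h1 : θ₀ ≤ 1)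
    {D : Set (EuclideanSpace ℝ (Fin n))} {g : EuclideanSpace ℝ (Fin n) → ℝ}
    (hg : ConvexOn ℝ D g) {x : ℕ → EuclideanSpace ℝ (Fin n)} (hx : ∀ i, x i ∈ D) (k : ℕ) :
    ringPoint r θ₀ x k ∈ D ∧ totalWeight r θ₀ k * g (ringPoint r θ₀ x k) ≤
      ∑ i ∈ range k, headWeight r θ₀ k i * g (x i) + lastWeight θ₀ k * g (x k) := by
  set w : ℕ → ℝ := fun i => if i < k then headWeight r θ₀ k i else lastWeight θ₀ k with hw
  have hwk : ∀ i ∈ range k, w i = headWeight r θ₀ k i := fun i hi => if_pos (mem_range.1 hi)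
  have hw0 : ∀ i ∈ range (k + 1), 0 ≤ w i := by
    intro i _
    simp only [hw]
    split_ifs
    · exact headWeight_nonneg hr h h1 k i
    · exact (lastWeight_pos h k).le
  have hsum : ∑ i ∈ range (k + 1), w i = totalWeight r θ₀ k := by
    rw [sum_range_succ, sum_congr rfl hwk, totalWeight, hw]
    simp
  have hW := totalWeight_pos hr h h1 k
  have hpos : 0 < ∑ i ∈ range (k + 1), w i := hsum ▸ hW
  have hcv := hg.map_centerMass_le hw0 hpos fun i _ => hx i
  rw [← ringPoint_eq_centerMass, centerMass, hsum] at hcv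
  refine ⟨?_, ?_⟩
  · rw [ringPoint_eq_centerMass]
    exact hg.1.centerMass_mem hw0 hpos fun i _ => hx i
  · have h2 := mul_le_mul_of_nonneg_left hcv hW.le
    rw [smul_eq_mul, mul_inv_cancel_left₀ hW.ne', sum_range_succ] at h2
    refine h2.trans_eq ?_
    congr 1
    · exact sum_congr rfl fun i hi => by rw [hwk i hi]; rfl
    · simp [hw]

end Convexity

/-! ### The iterates as convex combinations, and the energy along them. -/

section Iterates

variable {n : ℕ} {f : EuclideanSpace ℝ (Fin n) → ℝ} {ψ : Fin n → ℝ → EReal} {v : Fin n → ℝ}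

theorem dependsOn_iterate (f : EuclideanSpace ℝ (Fin n) → ℝ) (ψ : Fin n → ℝ → EReal)
    (v : Fin n → ℝ) (τ : ℝ) (x₀ : EuclideanSpace ℝ (Fin n)) {j k : ℕ} (hjk : j ≤ k) :
    DependsOn (fun A => iterate f ψ v τ x₀ A j) (range k) := by
  induction j with
  | zero => exact fun A B _ => rfl
  | succ j ih =>
    intro A B hAB
    have h := ih (by omega) hAB
    simp only at h
    simp only [iterate, h, hAB j (mem_coe.2 (mem_range.2 hjk))]

theorem iterate_snd_mem_dom (hbot : ∀ i t, ψ i t ≠ ⊥) (hψ : IsClosedConvex (separable ψ))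
    (hv : ∀ i, 0 < v i) {τ : ℝ} (hτ : 0 < τ) (hθ : 0 < τ / n) {x₀ : EuclideanSpace ℝ (Fin n)}
    (hx₀ : x₀ ∈ dom ψ) (A : ℕ → Finset (Fin n)) (k : ℕ) :
    (iterate f ψ v τ x₀ A k).2 ∈ dom ψ := by
  induction k with
  | zero => exact hx₀
  | succ k ih => exact zUpdate_mem_dom hbot hψ hv hτ (theta_pos hθ k) _ _ ih

/-- Since the update of `x` extrapolates, membership of `x_k` in the domain is not visible stepwise;
it follows from this representation and the nonnegativity of `γ`. -/
theorem iterate_fst_eq_gammaSum (f : EuclideanSpace ℝ (Fin n) → ℝ) (ψ : Fin n → ℝ → EReal)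
    (v : Fin n → ℝ) {τ : ℝ} (hr : n / τ * (τ / n) = 1) (x₀ : EuclideanSpace ℝ (Fin n))
    (A : ℕ → Finset (Fin n)) (k : ℕ) :
    (iterate f ψ v τ x₀ A k).1 =
      gammaSum (n / τ) (τ / n) (fun i => (iterate f ψ v τ x₀ A i).2) k := by
  induction k with
  | zero => rw [gammaSum_zero]; rfl
  | succ k ih =>
    rw [gammaSum_succ hr, ← ih]
    rfl

theorem gammaSum_mem_and_le {r θ₀ : ℝ} (hr : r * θ₀ = 1) (h : 0 < θ₀) (h1 : θ₀ ≤ 1)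
    {D : Set (EuclideanSpace ℝ (Fin n))} {g : EuclideanSpace ℝ (Fin n) → ℝ}
    (hg : ConvexOn ℝ D g) {z : ℕ → EuclideanSpace ℝ (Fin n)} (hz : ∀ i, z i ∈ D) (k : ℕ) :
    gammaSum r θ₀ z k ∈ D ∧ g (gammaSum r θ₀ z k) ≤ gammaSum r θ₀ (fun i => g (z i)) k :=
  ⟨hg.1.sum_mem (fun i _ => gamma_nonneg hr h h1 k i) (sum_gamma hr k) fun i _ => hz i,
    hg.map_sum_le (fun i _ => gamma_nonneg hr h h1 k i) (sum_gamma hr k) fun i _ => hz i⟩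

/-- The Lyapunov function of APPROX after `k` steps, with the comparison point `u`. -/
noncomputable def energy (f : EuclideanSpace ℝ (Fin n) → ℝ) (ψ : Fin n → ℝ → EReal)
    (v : Fin n → ℝ) (τ : ℝ) (x₀ u : EuclideanSpace ℝ (Fin n)) (k : ℕ)
    (A : ℕ → Finset (Fin n)) : ℝ :=
  invSqPrev (τ / n) k * (f (iterate f ψ v τ x₀ A k).1
      + gammaSum (n / τ) (τ / n) (fun i => sepReal ψ (iterate f ψ v τ x₀ A i).2) k
      - (f u + sepReal ψ u))
    + (n / τ) ^ 2 / 2 * wnormSq v ((iterate f ψ v τ x₀ A k).2 - u)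

theorem dependsOn_energy (f : EuclideanSpace ℝ (Fin n) → ℝ) (ψ : Fin n → ℝ → EReal)
    (v : Fin n → ℝ) (τ : ℝ) (x₀ u : EuclideanSpace ℝ (Fin n)) {j k : ℕ} (hjk : j ≤ k) :
    DependsOn (energy f ψ v τ x₀ u j) (range k) := by
  intro A B hAB
  have h : ∀ i ≤ j, iterate f ψ v τ x₀ A i = iterate f ψ v τ x₀ B i := fun i hi =>
    dependsOn_iterate f ψ v τ x₀ (hi.trans hjk) hAB
  have h2 : gammaSum (n / τ) (τ / n) (fun i => sepReal ψ (iterate f ψ v τ x₀ A i).2) j =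
      gammaSum (n / τ) (τ / n) (fun i => sepReal ψ (iterate f ψ v τ x₀ B i).2) j :=
    sum_congr rfl fun i hi => by
      simp only [h i (Nat.lt_succ_iff.1 (mem_range.1 hi))]
  rw [energy, energy, h j le_rfl, h2]

/-- The step inequality with `c` equal to the surrogate `∑ γ_k^i ψ(z_i)`, which follows the
recursion `gammaSum_succ`. Changing sample `k` leaves the iterates up to time `k` intact. -/
theorem sampleMean_energy_succ_le (hf_diff : Differentiable ℝ f)
    (hf_conv : ConvexOn ℝ Set.univ f) (hbot : ∀ i t, ψ i t ≠ ⊥)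
    (hψ : IsClosedConvex (separable ψ)) (hv : ∀ i, 0 < v i)
    {p : PMF (Finset (Fin n))} (hp : ∀ i j, inclusionProb p i = inclusionProb p j)
    (hp_pos : 0 < meanSize p) (heso : ESO f p v) {x₀ u : EuclideanSpace ℝ (Fin n)}
    (hx₀ : x₀ ∈ dom ψ) (hu : u ∈ dom ψ) (k : ℕ) (A : ℕ → Finset (Fin n)) :
    sampleMean p (fun B => energy f ψ v (meanSize p) x₀ u (k + 1) (Function.update A k B)) ≤
      energy f ψ v (meanSize p) x₀ u k A := by
  have hn : (0 : ℝ) < n := hp_pos.trans_le (meanSize_le p)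
  have hθ₀ : 0 < meanSize p / n := div_pos hp_pos hn
  have hθ₁ : meanSize p / n ≤ 1 := (div_le_one hn).2 (meanSize_le p)
  have hr : n / meanSize p * (meanSize p / n) = 1 := by field_simp
  have h := sampleMean_step_le hf_diff hf_conv hbot hψ hv hp hp_pos heso (theta_pos hθ₀ k)
    ((theta_le hθ₀ k).trans hθ₁) (iterate f ψ v (meanSize p) x₀ A k).1
    (iterate_snd_mem_dom (f := f) hbot hψ hv hp_pos hθ₀ hx₀ A k) hu
    (gammaSum (n / meanSize p) (meanSize p / n)
      (fun i => sepReal ψ (iterate f ψ v (meanSize p) x₀ A i).2) k)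
  rw [energy, invSqPrev_eq hθ₀]
  refine le_of_eq_of_le ?_ h
  congr 1
  ext B
  have h1 : ∀ i ≤ k, iterate f ψ v (meanSize p) x₀ (Function.update A k B) i =
      iterate f ψ v (meanSize p) x₀ A i := fun i hi =>
    dependsOn_iterate f ψ v _ x₀ hi fun l hl =>
      Function.update_of_ne (mem_range.1 (mem_coe.1 hl)).ne _ _
  have h2 : gammaSum (n / meanSize p) (meanSize p / n)
      (fun i => sepReal ψ (iterate f ψ v (meanSize p) x₀ (Function.update A k B) i).2) k =
      gammaSum (n / meanSize p) (meanSize p / n)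
        (fun i => sepReal ψ (iterate f ψ v (meanSize p) x₀ A i).2) k :=
    sum_congr rfl fun i hi => by
      simp only [h1 i (Nat.lt_succ_iff.1 (mem_range.1 hi))]
  rw [energy, gammaSum_succ hr, h2]
  simp only [iterate, h1 k le_rfl, Function.update_self, invSqPrev, smul_eq_mul]

theorem lyapunov_eq (hbot : ∀ i t, ψ i t ≠ ⊥) (θ₀ : ℝ) {u x : EuclideanSpace ℝ (Fin n)}
    (hu : u ∈ dom ψ) (hx : x ∈ dom ψ) : lyapunov (objective f ψ) v θ₀ u x =
      (1 - θ₀) / θ₀ ^ 2 * (f x + sepReal ψ x - (f u + sepReal ψ u))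
        + 1 / (2 * θ₀ ^ 2) * wnormSq v (x - u) := by
  rw [lyapunov, objective_eq_coe f hbot hx, objective_eq_coe f hbot hu, EReal.toReal_coe,
    EReal.toReal_coe]

theorem convexOn_lyapunov (hf_conv : ConvexOn ℝ Set.univ f) (hbot : ∀ i t, ψ i t ≠ ⊥)
    (hψ : IsClosedConvex (separable ψ)) (hv : ∀ i, 0 < v i) {θ₀ : ℝ} (h1 : θ₀ ≤ 1)
    {u : EuclideanSpace ℝ (Fin n)} (hu : u ∈ dom ψ) :
    ConvexOn ℝ (dom ψ) (lyapunov (objective f ψ) v θ₀ u) := by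
  have hs := convexOn_sepReal hbot hψ
  have hF : ConvexOn ℝ (dom ψ) fun x => f x + sepReal ψ x :=
    (hf_conv.subset (Set.subset_univ _) hs.1).add hs
  have hw := (convexOn_wnormSq_sub hv u).subset (Set.subset_univ (dom ψ)) hs.1
  have hc : 0 ≤ (1 - θ₀) / θ₀ ^ 2 := div_nonneg (sub_nonneg.2 h1) (sq_nonneg _)
  refine ((((hF.add_const (-(f u + sepReal ψ u))).smul hc).add
    (hw.smul (show 0 ≤ 1 / (2 * θ₀ ^ 2) by positivity)))).congr fun x hx => ?_
  rw [lyapunov_eq hbot θ₀ hu hx]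
  simp only [Pi.add_apply, smul_eq_mul]
  ring

/-- The weighted sum of the energies dominates the gap at the averaged point and the Lyapunov
function at the last iterate. -/
theorem totalWeight_mul_gap_add_lyapunov_le (hf_conv : ConvexOn ℝ Set.univ f)
    (hbot : ∀ i t, ψ i t ≠ ⊥) (hψ : IsClosedConvex (separable ψ)) (hv : ∀ i, 0 < v i)
    {τ : ℝ} (hτ : 0 < τ) (hn : (0 : ℝ) < n) (hτn : τ ≤ n) {x₀ u : EuclideanSpace ℝ (Fin n)}
    (hx₀ : x₀ ∈ dom ψ) (hu : u ∈ dom ψ) {k : ℕ} (hk : 1 ≤ k) (A : ℕ → Finset (Fin n)) :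
    let x := fun j => (iterate f ψ v τ x₀ A j).1
    let xr := ringPoint (n / τ) (τ / n) x k
    totalWeight (n / τ) (τ / n) k * (f xr + sepReal ψ xr - (f u + sepReal ψ u))
        + lyapunov (objective f ψ) v (τ / n) u (x k) ≤
      ∑ i ∈ range (k + 1), gamma (n / τ) (τ / n) k i * energy f ψ v τ x₀ u i A := by
  intro x xr
  have hθ₀ : 0 < τ / n := div_pos hτ hn
  have hθ₁ : τ / n ≤ 1 := (div_le_one hn).2 hτn
  have hr : n / τ * (τ / n) = 1 := by field_simp
  have hz := iterate_snd_mem_dom (f := f) hbot hψ hv hτ hθ₀ hx₀ A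
  have hs := convexOn_sepReal hbot hψ
  have hF : ConvexOn ℝ (dom ψ) fun x => f x + sepReal ψ x :=
    (hf_conv.subset (Set.subset_univ _) hs.1).add hs
  have hxz := iterate_fst_eq_gammaSum f ψ v hr x₀ A
  have hx : ∀ j, x j ∈ dom ψ ∧ sepReal ψ (x j) ≤
      gammaSum (n / τ) (τ / n) (fun i => sepReal ψ (iterate f ψ v τ x₀ A i).2) j := by
    intro j
    simp only [x, hxz j]
    exact gammaSum_mem_and_le hr hθ₀ hθ₁ hs hz j
  have hring := (ringPoint_mem_and_le hr hθ₀ hθ₁ (hF.add_const (-(f u + sepReal ψ u)))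
    (fun i => (hx i).1) k).2
  have hw : wnormSq v (x k - u) ≤ ∑ i ∈ range (k + 1), gamma (n / τ) (τ / n) k i *
      wnormSq v ((iterate f ψ v τ x₀ A i).2 - u) := by
    simp only [x, hxz k]
    exact (gammaSum_mem_and_le hr hθ₀ hθ₁ (convexOn_wnormSq_sub hv u)
      (fun i => Set.mem_univ _) k).2
  have hle : ∑ i ∈ range (k + 1), (headWeight (n / τ) (τ / n) k i *
        (f (x i) + sepReal ψ (x i) + -(f u + sepReal ψ u))
        + (n / τ) ^ 2 / 2 * (gamma (n / τ) (τ / n) k i *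
          wnormSq v ((iterate f ψ v τ x₀ A i).2 - u))) ≤
      ∑ i ∈ range (k + 1), gamma (n / τ) (τ / n) k i * energy f ψ v τ x₀ u i A := by
    refine sum_le_sum fun i _ => ?_
    have h1 := mul_le_mul_of_nonneg_left (hx i).2 (headWeight_nonneg hr hθ₀ hθ₁ k i)
    rw [energy, headWeight]
    rw [headWeight] at h1
    simp only [x] at h1 ⊢
    linarith
  refine le_trans ?_ hle
  -- The term `i = k` is split: `lastWeight` goes to the averaged gap, the remaining `(1 - θ₀) / θ₀
  -- ^ 2` to the Lyapunov function at `x k`.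
  rw [sum_add_distrib, ← mul_sum, sum_range_succ, ← lastWeight_add hr hθ₀ hk,
    lyapunov_eq hbot _ hu (hx k).1]
  have hsq : 1 / (2 * (τ / n) ^ 2) = (n / τ) ^ 2 / 2 := by field_simp
  rw [hsq]
  have hw' := mul_le_mul_of_nonneg_left hw (show 0 ≤ ((n : ℝ) / τ) ^ 2 / 2 by positivity)
  simp only [Pi.add_apply] at hring
  change totalWeight (n / τ) (τ / n) k * (f xr + sepReal ψ xr + -(f u + sepReal ψ u)) ≤ _ at hring
  linarith

/-- Quadratic growth bounds the Lyapunov function by the gap. -/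
theorem mCoeff_mul_lyapunov_le (hbot : ∀ i t, ψ i t ≠ ⊥) {r θ₀ μ : ℝ} (hr : r * θ₀ = 1)
    (h : 0 < θ₀) (h1 : θ₀ ≤ 1) (hμ : 0 < μ) {u x : EuclideanSpace ℝ (Fin n)} (hu : u ∈ dom ψ)
    (hx : x ∈ dom ψ)
    (hg : μ / 2 * wnormSq v (x - u) ≤ f x + sepReal ψ x - (f u + sepReal ψ u)) (k : ℕ) :
    mCoeff r θ₀ k μ * lyapunov (objective f ψ) v θ₀ u x ≤
      totalWeight r θ₀ k * (f x + sepReal ψ x - (f u + sepReal ψ u)) := by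
  rw [lyapunov_eq hbot θ₀ hu hx, mCoeff]
  set d := f x + sepReal ψ x - (f u + sepReal ψ u)
  have hW := totalWeight_pos hr h h1 k
  have hden : 0 < 1 + μ * (1 - θ₀) := by nlinarith
  have h2 : μ * θ₀ ^ 2 / (1 + μ * (1 - θ₀)) *
      ((1 - θ₀) / θ₀ ^ 2 * d + 1 / (2 * θ₀ ^ 2) * wnormSq v (x - u)) ≤ d := by
    rw [div_mul_eq_mul_div, div_le_iff₀ hden]
    have : μ * θ₀ ^ 2 * ((1 - θ₀) / θ₀ ^ 2 * d + 1 / (2 * θ₀ ^ 2) * wnormSq v (x - u)) =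
        μ * (1 - θ₀) * d + μ / 2 * wnormSq v (x - u) := by
      field_simp
    rw [this]
    linarith
  have h3 := mul_le_mul_of_nonneg_left h2 hW.le
  linarith

end Iterates

/-! ### Expected energy is bounded by its initial value. -/

section Expectation

variable {n : ℕ} {f : EuclideanSpace ℝ (Fin n) → ℝ} {ψ : Fin n → ℝ → EReal} {v : Fin n → ℝ}
  {p : PMF (Finset (Fin n))} {Ω : Type*} [MeasurableSpace Ω] {P : Measure Ω}
  [IsProbabilityMeasure P] {S : ℕ → Ω → Finset (Fin n)}

/-- At time zero the surrogate is exact, because `γ_0^0 = 1` and `z₀ = x₀`. -/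
theorem energy_zero (hbot : ∀ i t, ψ i t ≠ ⊥) (τ : ℝ) {x₀ u : EuclideanSpace ℝ (Fin n)}
    (hx₀ : x₀ ∈ dom ψ) (hu : u ∈ dom ψ) (A : ℕ → Finset (Fin n)) :
    energy f ψ v τ x₀ u 0 A = lyapunov (objective f ψ) v (τ / n) u x₀ := by
  have hsq : 1 / (2 * (τ / n) ^ 2) = (n / τ) ^ 2 / 2 := by
    rw [div_pow, div_pow, one_div, mul_inv, inv_div]
    ring
  rw [energy, gammaSum_zero, lyapunov_eq hbot _ hu hx₀, hsq]
  rfl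

theorem integral_energy_le (hf_diff : Differentiable ℝ f) (hf_conv : ConvexOn ℝ Set.univ f)
    (hbot : ∀ i t, ψ i t ≠ ⊥) (hψ : IsClosedConvex (separable ψ)) (hv : ∀ i, 0 < v i)
    (hp : ∀ i j, inclusionProb p i = inclusionProb p j)
    (hp_pos : 0 < meanSize p) (heso : ESO f p v)
    (hS : ∀ k A, MeasurableSet (S k ⁻¹' {A})) (hlaw : ∀ k A, P (S k ⁻¹' {A}) = p A)
    (hind : iIndepFun (m := fun _ => ⊤) S P) {x₀ u : EuclideanSpace ℝ (Fin n)}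
    (hx₀ : x₀ ∈ dom ψ) (hu : u ∈ dom ψ) (k : ℕ) :
    ∫ ω, energy f ψ v (meanSize p) x₀ u k (fun l => S l ω) ∂P ≤
      lyapunov (objective f ψ) v (meanSize p / n) u x₀ := by
  induction k with
  | zero => simp [energy_zero hbot _ hx₀ hu]
  | succ k ih =>
    refine le_trans ?_ ih
    exact integral_le_of_sampleMean_update_le hS hlaw hind
      (dependsOn_energy f ψ v _ x₀ u le_rfl) (dependsOn_energy f ψ v _ x₀ u le_rfl)
      (sampleMean_energy_succ_le hf_diff hf_conv hbot hψ hv hp hp_pos heso hx₀ hu k)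

end Expectation

end Approx

/-! ### The restart inequality. -/

theorem mainTheorem1 {n : ℕ}
    (f : EuclideanSpace ℝ (Fin n) → ℝ) (hf_diff : Differentiable ℝ f)
    (hf_conv : ConvexOn ℝ Set.univ f)
    (ψ : Fin n → ℝ → EReal) (hψ_bot : ∀ i t, ψ i t ≠ ⊥)
    (hψ : Approx.IsClosedConvex (Approx.separable ψ))
    (xs : EuclideanSpace ℝ (Fin n))
    (hxs : ∀ x, Approx.objective f ψ xs ≤ Approx.objective f ψ x)
    (v : Fin n → ℝ) (hv : ∀ i, 0 < v i)
    (μ : ℝ) (hμ : 0 < μ)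
    (hgrowth : ∀ x, Approx.objective f ψ xs + ((μ / 2 * Approx.wnormSq v (x - xs) : ℝ) : EReal)
      ≤ Approx.objective f ψ x)
    (p : PMF (Finset (Fin n)))
    (hp_unif : ∀ i j, Approx.inclusionProb p i = Approx.inclusionProb p j)
    (hp_pos : 0 < Approx.meanSize p)
    (heso : Approx.ESO f p v)
    {Ω : Type*} [MeasurableSpace Ω] (P : Measure Ω) [IsProbabilityMeasure P]
    (S : ℕ → Ω → Finset (Fin n))
    (hS_meas : ∀ k A, MeasurableSet (S k ⁻¹' {A}))
    (hS_law : ∀ k A, P (S k ⁻¹' {A}) = p A)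
    (hS_indep : iIndepFun (m := fun _ => ⊤) S P)
    (x₀ : EuclideanSpace ℝ (Fin n)) (hx₀ : Approx.separable ψ x₀ ≠ ⊤)
    (σ : ℝ) (hσ : σ ∈ Set.Icc (0 : ℝ) 1) (k : ℕ) (hk : 1 ≤ k) :
    let τ : ℝ := Approx.meanSize p
    let θ₀ : ℝ := τ / n
    let F := Approx.objective f ψ
    let Δ := Approx.lyapunov F v θ₀ xs
    let xbar : Ω → EuclideanSpace ℝ (Fin n) := fun ω =>
      Approx.barPoint (n / τ) θ₀ σ
        (fun j => (Approx.iterate f ψ v τ x₀ (fun l => S l ω) j).1) k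
    -- the averaging weights are nonnegative and do not all vanish
    ((∀ i < k, 0 ≤ Approx.headWeight (n / τ) θ₀ k i) ∧ 0 ≤ Approx.lastWeight θ₀ k ∧
      0 < Approx.totalWeight (n / τ) θ₀ k) ∧
    -- the expectation is that of an integrable, everywhere finite quantity
    (∀ ω, F (xbar ω) ≠ ⊤) ∧ Integrable (fun ω => Δ (xbar ω)) P ∧
    ∫ ω, Δ (xbar ω) ∂P ≤ max σ (1 - σ * Approx.mCoeff (n / τ) θ₀ k μ) * Δ x₀ := by
  intro τ θ₀ F Δ xbar
  have hτn : τ ≤ n := Approx.meanSize_le p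
  have hn : (0 : ℝ) < n := hp_pos.trans_le hτn
  have hθ₀ : 0 < θ₀ := div_pos hp_pos hn
  have hθ₁ : θ₀ ≤ 1 := (div_le_one hn).2 hτn
  have hτ0 : τ ≠ 0 := hp_pos.ne'
  have hr : n / τ * θ₀ = 1 := by simp only [θ₀]; field_simp
  have hW := Approx.totalWeight_pos hr hθ₀ hθ₁ k
  have hx₀d : x₀ ∈ Approx.dom ψ := Approx.mem_dom_of_separable_ne_top hψ_bot hx₀
  have hud : xs ∈ Approx.dom ψ := by
    refine Approx.mem_dom_of_separable_ne_top hψ_bot fun htop => ?_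
    have h := hxs x₀
    rw [Approx.objective_eq_coe f hψ_bot hx₀d, Approx.objective, htop, EReal.coe_add_top,
      top_le_iff] at h
    exact EReal.coe_ne_top _ h
  have hgap : ∀ x ∈ Approx.dom ψ, μ / 2 * Approx.wnormSq v (x - xs) ≤
      f x + Approx.sepReal ψ x - (f xs + Approx.sepReal ψ xs) := by
    intro x hx
    have h := hgrowth x
    rw [Approx.objective_eq_coe f hψ_bot hx, Approx.objective_eq_coe f hψ_bot hud,
      ← EReal.coe_add, EReal.coe_le_coe_iff] at h
    linarith
  have hΔ : ConvexOn ℝ (Approx.dom ψ) Δ :=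
    Approx.convexOn_lyapunov hf_conv hψ_bot hψ hv hθ₁ hud
  let x : (ℕ → Finset (Fin n)) → ℕ → EuclideanSpace ℝ (Fin n) := fun A j =>
    (Approx.iterate f ψ v τ x₀ A j).1
  let xr : (ℕ → Finset (Fin n)) → ℕ → EuclideanSpace ℝ (Fin n) := fun A =>
    Approx.ringPoint (n / τ) θ₀ (x A)
  have hx : ∀ A j, x A j ∈ Approx.dom ψ := by
    intro A j
    simp only [x, Approx.iterate_fst_eq_gammaSum f ψ v hr x₀ A j]
    exact (Approx.gammaSum_mem_and_le hr hθ₀ hθ₁ (Approx.convexOn_sepReal hψ_bot hψ)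
      (Approx.iterate_snd_mem_dom (f := f) hψ_bot hψ hv hp_pos hθ₀ hx₀d A) j).1
  have hxr : ∀ A j, xr A j ∈ Approx.dom ψ ∧ Approx.totalWeight (n / τ) θ₀ j * Δ (xr A j) ≤
      ∑ i ∈ range j, Approx.headWeight (n / τ) θ₀ j i * Δ (x A i)
        + Approx.lastWeight θ₀ j * Δ (x A j) := fun A j =>
    Approx.ringPoint_mem_and_le hr hθ₀ hθ₁ hΔ (hx A) j
  have dep_x : ∀ j l, j ≤ l → DependsOn (fun A => x A j) (range l) := fun j l hjl A B hAB =>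
    congrArg Prod.fst (Approx.dependsOn_iterate f ψ v τ x₀ hjl hAB)
  have dep_xr : DependsOn (fun A => xr A k) (range k) := by
    intro A B hAB
    have h : ∀ j ≤ k, x A j = x B j := fun j hj => dep_x j k hj hAB
    simp only [xr, Approx.ringPoint, h k le_rfl]
    congr 2
    exact sum_congr rfl fun i hi => by rw [h i (mem_range.1 hi).le]
  have int_of_dep : ∀ {l : ℕ} {g : (ℕ → Finset (Fin n)) → ℝ}, DependsOn g (range l) →
      Integrable (fun ω => g fun m => S m ω) P := fun hg =>
    Approx.integrable_of_dependsOn hS_meas hg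
  have int_x : ∀ j, Integrable (fun ω => Δ (x (fun m => S m ω) j)) P := fun j =>
    int_of_dep (g := fun A => Δ (x A j)) fun A B hAB => congrArg Δ (dep_x j j le_rfl hAB)
  have int_xr : Integrable (fun ω => Δ (xr (fun m => S m ω) k)) P :=
    int_of_dep (g := fun A => Δ (xr A k)) fun A B hAB => congrArg Δ (dep_xr hAB)
  have int_bar : Integrable (fun ω => Δ (xbar ω)) P := by
    refine int_of_dep (l := k) (g := fun A => Δ (σ • x A k + (1 - σ) • xr A k)) ?_
    intro A B hAB
    have h1 : x A k = x B k := dep_x k k le_rfl hAB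
    have h2 : xr A k = xr B k := dep_xr hAB
    simp only [h1, h2]
  have int_energy : ∀ i, Integrable
      (fun ω => Approx.energy f ψ v τ x₀ xs i fun m => S m ω) P := fun i =>
    int_of_dep (Approx.dependsOn_energy f ψ v τ x₀ xs le_rfl)
  have hsum : ∀ j, ∫ ω, ∑ i ∈ range (j + 1), Approx.gamma (n / τ) θ₀ j i *
      Approx.energy f ψ v τ x₀ xs i (fun m => S m ω) ∂P ≤ Δ x₀ := by
    intro j
    rw [integral_finsetSum _ fun i _ => (int_energy i).const_mul _]
    simp only [integral_const_mul]
    calc _ ≤ ∑ i ∈ range (j + 1), Approx.gamma (n / τ) θ₀ j i * Δ x₀ :=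
          sum_le_sum fun i _ => mul_le_mul_of_nonneg_left
            (Approx.integral_energy_le hf_diff hf_conv hψ_bot hψ hv hp_unif hp_pos heso hS_meas
              hS_law hS_indep hx₀d hud i) (Approx.gamma_nonneg hr hθ₀ hθ₁ j i)
      _ = Δ x₀ := by rw [← sum_mul, Approx.sum_gamma hr, one_mul]
  have int_sum : ∀ j, Integrable (fun ω => ∑ i ∈ range (j + 1), Approx.gamma (n / τ) θ₀ j i *
      Approx.energy f ψ v τ x₀ xs i (fun m => S m ω)) P := fun j =>
    integrable_finsetSum _ fun i _ => (int_energy i).const_mul _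
  have hpath := fun (j : ℕ) (hj : 1 ≤ j) A =>
    Approx.totalWeight_mul_gap_add_lyapunov_le hf_conv hψ_bot hψ hv hp_pos hn hτn hx₀d hud hj A
  -- The gap at the averaged point is nonnegative and is dropped from the pathwise bound. That bound
  -- needs `1 ≤ j`, so `j = 0` is separate.
  have hlast : ∀ j, ∫ ω, Δ (x (fun m => S m ω) j) ∂P ≤ Δ x₀ := by
    intro j
    rcases Nat.eq_zero_or_pos j with rfl | hj
    · exact le_of_eq (by simp [x, Approx.iterate])
    · refine (integral_mono (int_x j) (int_sum j) fun ω => ?_).trans (hsum j)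
      have h1 := hpath j hj fun m => S m ω
      have h2 := hgap _ (hxr (fun m => S m ω) j).1
      have h3 := mul_nonneg (Approx.totalWeight_pos hr hθ₀ hθ₁ j).le
        ((mul_nonneg (half_pos hμ).le (Approx.wnormSq_nonneg hv _)).trans h2)
      exact (le_add_of_nonneg_left h3).trans h1
  have hring : ∫ ω, Δ (xr (fun m => S m ω) k) ∂P ≤ Δ x₀ := by
    have h1 : Approx.totalWeight (n / τ) θ₀ k * ∫ ω, Δ (xr (fun m => S m ω) k) ∂P ≤
        Approx.totalWeight (n / τ) θ₀ k * Δ x₀ := by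
      rw [← integral_const_mul]
      refine (integral_mono (int_xr.const_mul _) ((integrable_finsetSum _ fun i _ =>
        (int_x i).const_mul _).add ((int_x k).const_mul _))
        fun ω => (hxr (fun m => S m ω) k).2).trans ?_
      simp only [Pi.add_apply]
      rw [integral_add (integrable_finsetSum _ fun i _ => (int_x i).const_mul _)
        ((int_x k).const_mul _), integral_finsetSum _ fun i _ => (int_x i).const_mul _]
      simp only [integral_const_mul]
      rw [Approx.totalWeight, add_mul, sum_mul]
      exact add_le_add (sum_le_sum fun i _ => mul_le_mul_of_nonneg_left (hlast i)
        (Approx.headWeight_nonneg hr hθ₀ hθ₁ k i))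
        (mul_le_mul_of_nonneg_left (hlast k) (Approx.lastWeight_pos hθ₀ k).le)
    exact le_of_mul_le_mul_left h1 hW
  have hmain : Approx.mCoeff (n / τ) θ₀ k μ * ∫ ω, Δ (xr (fun m => S m ω) k) ∂P
      + ∫ ω, Δ (x (fun m => S m ω) k) ∂P ≤ Δ x₀ := by
    rw [← integral_const_mul, ← integral_add (int_xr.const_mul _) (int_x k)]
    refine (integral_mono ((int_xr.const_mul _).add (int_x k)) (int_sum k) fun ω => ?_).trans
      (hsum k)
    have h1 := hpath k hk fun m => S m ω
    have h2 := Approx.mCoeff_mul_lyapunov_le hψ_bot hr hθ₀ hθ₁ hμ hud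
      (hxr (fun m => S m ω) k).1 (hgap _ (hxr (fun m => S m ω) k).1) k
    exact (add_le_add_left h2 _).trans h1
  have hbar : ∫ ω, Δ (xbar ω) ∂P ≤ σ * ∫ ω, Δ (x (fun m => S m ω) k) ∂P
      + (1 - σ) * ∫ ω, Δ (xr (fun m => S m ω) k) ∂P := by
    rw [← integral_const_mul, ← integral_const_mul,
      ← integral_add ((int_x k).const_mul _) (int_xr.const_mul _)]
    exact integral_mono int_bar (((int_x k).const_mul _).add (int_xr.const_mul _)) fun ω =>
      hΔ.2 (hx _ k) (hxr _ k).1 hσ.1 (sub_nonneg.2 hσ.2) (by ring)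
  have hring0 : 0 ≤ ∫ ω, Δ (xr (fun m => S m ω) k) ∂P := by
    refine integral_nonneg fun ω => ?_
    have hd := (hxr (fun m => S m ω) k).1
    have h2 := (mul_nonneg (half_pos hμ).le (Approx.wnormSq_nonneg hv _)).trans (hgap _ hd)
    change 0 ≤ Approx.lyapunov F v θ₀ xs (xr (fun m => S m ω) k)
    rw [Approx.lyapunov_eq hψ_bot θ₀ hud hd]
    exact add_nonneg (mul_nonneg (div_nonneg (sub_nonneg.2 hθ₁) (sq_nonneg _)) h2)
      (mul_nonneg (by positivity) (Approx.wnormSq_nonneg hv _))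
  refine ⟨⟨fun i _ => Approx.headWeight_nonneg hr hθ₀ hθ₁ k i, (Approx.lastWeight_pos hθ₀ k).le,
    hW⟩, fun ω => ?_, int_bar, hbar.trans ?_⟩
  · have hd : xbar ω ∈ Approx.dom ψ :=
      hΔ.1 (hx _ k) (hxr _ k).1 hσ.1 (sub_nonneg.2 hσ.2) (by ring)
    simp only [F, Approx.objective_eq_coe f hψ_bot hd]
    exact EReal.coe_ne_top _
  · set R := ∫ ω, Δ (xr (fun m => S m ω) k) ∂P
    set D := ∫ ω, Δ (x (fun m => S m ω) k) ∂P
    set m := Approx.mCoeff (n / τ) θ₀ k μ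
    have hD := mul_le_mul_of_nonneg_left hmain hσ.1
    have hΔ0 : 0 ≤ Δ x₀ := hring0.trans hring
    -- The sign of the coefficient of `R` decides which bound, `0 ≤ R` or `R ≤ Δ x₀`, is used.
    rcases le_total (1 - σ - σ * m) 0 with h | h
    · have h1 := mul_nonpos_of_nonpos_of_nonneg h hring0
      have h2 := mul_le_mul_of_nonneg_right (le_max_left σ (1 - σ * m)) hΔ0
      linarith
    · have h1 := mul_le_mul_of_nonneg_left hring h
      have h2 := mul_le_mul_of_nonneg_right (le_max_right σ (1 - σ * m)) hΔ0
      linarith
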